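/- Conventions. A manifold with corners of dimension $n$ is modelled on $[0,\infty)^n$; a point has depth $k$ if it has a neighbourhood of the form $\mathbb{R}^{n-k}\times[0,\infty)^k$ in which it corresponds to $0$. An open face of codimension $k$ is a connected component of the set of points of depth $k$; a face is the closure of an open face, and a hyperface is a face of codimension $1$. A defining function of a hyperface $H$ is a smooth $\rho\ge 0$ with $\rho^{-1}(0)=H$ and $d\rho\neq 0$ at every point of $H$; a manifold with corners has embedded faces if every hyperface has a defining function. Construction. Let $M$ be a compact connected manifold with corners with embedded faces and let $H_1,\dots,H_r$ be its (distinct) hyperfaces. Choose a defining function $\rho_i$ of each $H_i$ and a smooth embedding $\phi:M\to\mathbb{R}^N$. For $J\subset\{1,\dots,r\}$ put $F_J=\bigcap_{j\in J}H_j$, let $\mathcal J$ be the set of nonempty $J$ with $F_J\neq\emptyset$, and let $l=|\mathcal J|$. For $J\in\mathcal J$ let $n_J$ be the number of connected components of $F_J$, and choose a smooth $f_J:M\to\mathbb{R}$ which on $F_J$ takes values in $\{1,\dots,n_J\}$ and takes different values on different connected components of $F_J$. Put $$\Psi=(\phi,\rho_1,\dots,\rho_r,(f_J)_{J\in\mathcal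 J}):M\to X_0:=\mathbb{R}^N\times[0,\infty)^r\times\mathbb{R}^l,$$ $$Y_J=\{(z,x,y)\in X_0:\ y_J-\tfrac12\in\mathbb{Z},\ x_j=0\text{ for all }j\in J\},\qquad X_1=X_0\smallsetminus\bigcup_{J\in\mathcal J}Y_J,$$ and let $X_M$ be what is left of $X_1$ when all faces $F$ of $X_1$ with $F\cap\Psi(M)=\emptyset$ are removed. Proposition. For all such choices, $X_M$ is an open subset of $X_0$ (hence a manifold with corners) which contains $\Psi(M)$, and $\Psi:M\to X_M$ is a classifying space for $M$. That is: (a) $X_M$ has embedded faces, and each open face of $X_M$ is diffeomorphic to a Euclidean space; (b) $F\mapsto \Psi^{-1}(F)$ (that is, $F\mapsto F\cap M$) is a bijection from the set of open faces of $X_M$ onto the set of open faces of $M$; (c) $\Psi:M\to X_M$ is a closed embedding of manifolds with corners: it is smooth, injective, a homeomorphism onto a closed subset, and has injective differential everywhere; $d\Psi(T_xM)+T_yF=T_yX_M$ whenever $y=\Psi(x)$ lies in an open face $F$ of $X_M$; and each hyperface of $M$ is a connected component of the inverse image of a hyperface of $X_M$. -/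

import Mathlib

open scoped Manifold ContDiff Topology

noncomputable section

/-! ### Manifolds with corners: depth, faces, embedded faces -/

namespace Corners

section Basic

variable {E H : Type*} [NormedAddCommGroup E] [NormedSpace ℝ E] [TopologicalSpace H]
  (I : ModelWithCorners ℝ E H) {M : Type*} [TopologicalSpace M] [ChartedSpace H M]

/-- The tangent space at `x` of the open face through `x`, inside the tangent space of the whole
manifold at `x`. In the chart at `x` the manifold is an open piece of `range I`, a product
`ℝ^a × [0, ∞)^b`, and the space consists of the vectors `v` such that the segment
`x + t v`, `|t|` small, stays in `range I`; that is, `v i = 0` for every boundary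
coordinate `i` that vanishes at `x`. -/
def faceTangent (x : M) : Submodule ℝ (TangentSpace I x) :=
  Submodule.span ℝ
    {v : E | ∀ᶠ t : ℝ in 𝓝 0, extChartAt I x x + t • v ∈ Set.range I}

/-- The depth of `x`: the number `k` of boundary coordinates that vanish at `x`, so that `x` has a
neighbourhood of the form `ℝ^(n-k) × [0, ∞)^k` with `x` at the origin. -/
def depth (x : M) : ℕ :=
  Module.finrank ℝ E - Module.finrank ℝ (faceTangent I x)

/-- `F` is an open face of codimension `k`: a connected component of the set of points of
depth `k`. -/
def IsOpenFaceOfCodim (k : ℕ) (F : Set M) : Prop :=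
  ∃ x : M, depth I x = k ∧ F = connectedComponentIn {y : M | depth I y = k} x

/-- `F` is an open face (of some codimension). -/
def IsOpenFace (F : Set M) : Prop :=
  ∃ k, IsOpenFaceOfCodim I k F

/-- `F` is a (closed) face: the closure of an open face. -/
def IsFace (F : Set M) : Prop :=
  ∃ F₀ : Set M, IsOpenFace I F₀ ∧ F = closure F₀

/-- `F` is a hyperface: a face of codimension one. -/
def IsHyperface (F : Set M) : Prop :=
  ∃ F₀ : Set M, IsOpenFaceOfCodim I 1 F₀ ∧ F = closure F₀

/-- `ρ : M → [0, ∞)` is a defining function of the subset `A` (a hyperface). -/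
structure IsDefiningFunction (A : Set M) (ρ : M → ℝ) : Prop where
  nonneg : ∀ x, 0 ≤ ρ x
  smooth : ContMDiff I 𝓘(ℝ, ℝ) ∞ ρ
  zero_iff : ∀ x, ρ x = 0 ↔ x ∈ A
  deriv_ne_zero : ∀ x ∈ A, mfderiv I 𝓘(ℝ, ℝ) ρ x ≠ 0

variable (M) in
/-- Each hyperface of `M` has a defining function. -/
def HasEmbeddedFaces : Prop :=
  ∀ A : Set M, IsHyperface I A → ∃ ρ : M → ℝ, IsDefiningFunction I A ρ

/-- The subset `F`, an open face of `M`, is diffeomorphic to a Euclidean space: there are mutually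
inverse maps between `F` and some `ℝ^d` that are smooth for the smooth structure that `F`
inherits from `M`. -/
def IsDiffeomorphicToEuclidean (F : Set M) : Prop :=
  ∃ (d : ℕ) (h : EuclideanSpace ℝ (Fin d) → M) (g : M → EuclideanSpace ℝ (Fin d)),
    ContMDiff (𝓡 d) I ∞ h ∧ ContMDiffOn I (𝓡 d) ∞ g F ∧
    (∀ v, h v ∈ F) ∧ (∀ v, g (h v) = v) ∧ (∀ x ∈ F, h (g x) = x)

end Basic

section Maps

variable {E H E' H' : Type*}
  [NormedAddCommGroup E] [NormedSpace ℝ E] [TopologicalSpace H]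
  [NormedAddCommGroup E'] [NormedSpace ℝ E'] [TopologicalSpace H']
  (I : ModelWithCorners ℝ E H) (I' : ModelWithCorners ℝ E' H')
  {M X : Type*} [TopologicalSpace M] [ChartedSpace H M] [TopologicalSpace X] [ChartedSpace H' X]

/-- Closed embeddings of manifolds with corners. -/
structure IsClosedCornerEmbedding (f : M → X) : Prop where
  smooth : ContMDiff I I' ∞ f
  injective : Function.Injective f
  isClosed_range : IsClosed (Set.range f)
  mfderiv_injective : ∀ x, Function.Injective (mfderiv I I' f x)
  /-- `f(M)` is transverse to every open face `F` of `X`: `df(T_xM) + T_yF = T_yX` for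
  `y = f x ∈ F`. -/
  transverse : ∀ F : Set X, IsOpenFace I' F → ∀ x, f x ∈ F →
    LinearMap.range (mfderiv I I' f x).toLinearMap ⊔ faceTangent I' (f x) = ⊤
  /-- Each hyperface of `M` is a connected component of the inverse image of a hyperface
  of `X`. -/
  hyperface : ∀ A : Set M, IsHyperface I A → ∃ B : Set X, IsHyperface I' B ∧
    ∃ x ∈ f ⁻¹' B, A = connectedComponentIn (f ⁻¹' B) x

/-- The manifold with corners `X` with the map `f : M → X` is a classifying space for `M`. The
intersection of `M` with `F ⊆ X` is `f ⁻¹' F`, as a subset of `M`. -/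
structure IsClassifyingSpace [IsManifold I ∞ M] [IsManifold I' ∞ X] (f : M → X) : Prop where
  embeddedFaces : HasEmbeddedFaces I' X
  closedEmbedding : IsClosedCornerEmbedding I I' f
  /-- The map is also a homeomorphism onto its image. -/
  isEmbedding : Topology.IsEmbedding f
  euclidean : ∀ F : Set X, IsOpenFace I' F → IsDiffeomorphicToEuclidean I' F
  bijOn : Set.BijOn (fun F : Set X => f ⁻¹' F) {F | IsOpenFace I' F} {F | IsOpenFace I F}

end Maps

/-! ### The construction of `X_M` -/

section Construction

variable {n : ℕ} {M : Type*} [TopologicalSpace M] [ChartedSpace (EuclideanQuadrant n) M]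

/-- For a family `A` of subsets of `M`, the intersection `F_J = ⋂_{j ∈ J} A_j`. -/
def interFace {r : ℕ} (A : Fin r → Set M) (J : Finset (Fin r)) : Set M :=
  ⋂ j ∈ J, A j

/-- The nonempty sets `J` of indices for which `F_J` is not empty. -/
def IndexSets {r : ℕ} (A : Fin r → Set M) : Type :=
  {J : Finset (Fin r) // J.Nonempty ∧ (interFace A J).Nonempty}

instance {r : ℕ} (A : Fin r → Set M) : Fintype (IndexSets A) := by
  classical exact inferInstanceAs (Fintype {J : Finset (Fin r) // _})

variable (n M) in
/-- The choices on which the construction of `X_M` depends: an enumeration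
`A_1, …, A_r` of the hyperfaces of `M`, defining functions `ρ_i` of them, an embedding `φ`
of `M` into some `ℝ^N`, and for each `J` in the index set a smooth function `f_J` on `M`
which on `F_J` takes values in `{1, …, n_J}`, `n_J` being the number of connected components
of `F_J`, and takes different values on different components. -/
structure Choices where
  r : ℕ
  A : Fin r → Set M
  A_injective : Function.Injective A
  range_A : Set.range A = {B | IsHyperface (modelWithCornersEuclideanQuadrant n) B}
  ρ : Fin r → M → ℝ
  ρ_defining : ∀ i, IsDefiningFunction (modelWithCornersEuclideanQuadrant n) (A i) (ρ i)
  N : ℕ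
  φ : M → EuclideanSpace ℝ (Fin N)
  φ_smooth : ContMDiff (modelWithCornersEuclideanQuadrant n) (𝓡 N) ∞ φ
  φ_isEmbedding : Topology.IsEmbedding φ
  φ_immersion : ∀ x,
    Function.Injective (mfderiv (modelWithCornersEuclideanQuadrant n) (𝓡 N) φ x)
  f : IndexSets A → M → ℝ
  f_smooth : ∀ J, ContMDiff (modelWithCornersEuclideanQuadrant n) 𝓘(ℝ, ℝ) ∞ (f J)
  f_mem : ∀ J : IndexSets A, ∀ x ∈ interFace A J.1,
    ∃ k : ℕ, 1 ≤ k ∧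
      k ≤ {C : Set M | ∃ y ∈ interFace A J.1,
        C = connectedComponentIn (interFace A J.1) y}.ncard ∧
      f J x = k
  f_separates : ∀ J : IndexSets A, ∀ x ∈ interFace A J.1, ∀ y ∈ interFace A J.1,
    connectedComponentIn (interFace A J.1) x ≠ connectedComponentIn (interFace A J.1) y →
      f J x ≠ f J y

namespace Choices

variable (D : Choices n M)

/-- `X_0 = ℝ^N × [0, ∞)^r × ℝ^l`, where the last factor has one coordinate `y_J` for each `J`
in the index set. -/
abbrev X0 : Type :=
  EuclideanSpace ℝ (Fin D.N) × EuclideanQuadrant D.r × EuclideanSpace ℝ (IndexSets D.A)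

/-- The product model with corners of `X_0`. -/
abbrev model : ModelWithCorners ℝ
    (EuclideanSpace ℝ (Fin D.N) × EuclideanSpace ℝ (Fin D.r) × EuclideanSpace ℝ (IndexSets D.A))
    (ModelProd (EuclideanSpace ℝ (Fin D.N))
      (ModelProd (EuclideanQuadrant D.r) (EuclideanSpace ℝ (IndexSets D.A)))) :=
  (𝓡 D.N).prod ((modelWithCornersEuclideanQuadrant D.r).prod
    𝓘(ℝ, EuclideanSpace ℝ (IndexSets D.A)))

/-- `Ψ = (φ, ρ_1, …, ρ_r, f_J) : M → X_0`. -/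
def Ψ (x : M) : D.X0 :=
  (D.φ x, ⟨WithLp.toLp 2 fun i => D.ρ i x, fun i => (D.ρ_defining i).nonneg x⟩,
    WithLp.toLp 2 fun J => D.f J x)

/-- `Y_J = {(z, x, y) | y_J - 1/2 ∈ ℤ and x_j = 0 for all j ∈ J}`. -/
def Y (J : IndexSets D.A) : Set D.X0 :=
  {p | (∃ m : ℤ, p.2.2 J - 1 / 2 = m) ∧ ∀ j ∈ J.1, p.2.1.1 j = 0}

theorem isClosed_Y (J : IndexSets D.A) : IsClosed (D.Y J) := by
  have h1 : IsClosed {p : D.X0 | p.2.2 J - 1 / 2 ∈ Set.range ((↑) : ℤ → ℝ)} :=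
    Int.isClosedEmbedding_coe_real.isClosed_range.preimage (by fun_prop)
  have h2 : IsClosed {p : D.X0 | ∀ j ∈ J.1, p.2.1.1 j = 0} := by
    simp only [Set.ofPred_forall]
    refine isClosed_biInter fun j _ => isClosed_eq ?_ continuous_const
    have : Continuous fun p : D.X0 => p.2.1.1 :=
      continuous_subtype_val.comp (continuous_fst.comp continuous_snd)
    fun_prop
  convert h1.inter h2 using 1
  ext p
  simp [Y, eq_comm]

/-- `X_1 = X_0 ∖ ⋃_J Y_J`, an open submanifold of `X_0`. -/
def X1 : TopologicalSpace.Opens D.X0 :=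
  ⟨(⋃ J, D.Y J)ᶜ, (isClosed_iUnion_of_finite D.isClosed_Y).isOpen_compl⟩

/-- The underlying set of `X_M`: what is left of `X_1` when all faces of `X_1` that do not meet
`Ψ(M)` are removed. -/
def XMset : Set D.X0 :=
  Subtype.val '' (⋃₀ {F : Set D.X1 | IsFace D.model F ∧
    Disjoint (Subtype.val '' F) (Set.range D.Ψ)})ᶜ

end Choices

end Construction

end Corners

end

/-! Open faces on both sides are determined by discrete labels, and `Ψ` preserves the labels. On `M`
the label of `x` is the set `S` of hyperfaces through `x` together with the integers `f_J(x)`, `J ⊆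
S`. In a chart at `x` the hyperfaces through `x` are distinct coordinate hyperplanes: if two
hyperplanes belonged to one hyperface, the differential of its defining function would vanish at `x`
(`exists_coordinate_hyperfaces`). Hence depth counts hyperfaces, the `dρ_j` are independent
(`exists_mfderiv_eq`), the points of a component of `F_S` on no further hyperface form a connected
dense subset of it, and the open faces of `M` are the sets with constant label
(`connectedComponentIn_depth_eq`).

In `X_1` the coordinate `y_J` is never a half-integer where `x_j = 0` for all `j ∈ J`. So the open
faces are convex boxes `openBox S c`, with `x` vanishing exactly on `S` and `y_J` within `1/2` of an
integer `c J` for `J ⊆ S` (`connectedComponentIn_opens`); taking the closure only lets more `x_i`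
vanish (`closure_openBox`). A point survives iff the smallest face through it meets `Ψ(M)`, so `X_M`
is the union of the open sets `keptBy x` (`XMset_eq`). Its open faces are the boxes with `S` among
the hyperfaces through some `x` and `c = f(x)`; such a box pulls back to the open face of `M` with
the same label, whence the bijection.

For the rest, a box is a product of lines, open half-lines and intervals; transversality is the
independence of the `dρ_j`; the wall `x_i = 0` of `X_M` is one hyperface because `f_{i}` is constant
on the connected `H_i`; `φ` makes `Ψ` an immersive embedding, and compactness makes its image
closed. -/

noncomputable section

namespace Corners

/-! ### Depth as the number of vanishing boundary coordinates -/

section FaceTangent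

variable {E H : Type*} [NormedAddCommGroup E] [NormedSpace ℝ E] [TopologicalSpace H]
  {I : ModelWithCorners ℝ E H} {M : Type*} [TopologicalSpace M] [ChartedSpace H M]
  {ι : Type*} [Finite ι]

/-- A vanishing coordinate is linear along the segment and nonnegative for both signs of `t`, so its
slope is zero; a positive coordinate stays positive for small `t`. The map `c` lets one argument
serve the quadrant and the product model of `X_0`. -/
theorem eventually_add_smul_mem_range_iff (c : E →L[ℝ] (ι → ℝ))
    (hI : Set.range I = {e | ∀ i, 0 ≤ c e i}) {p : E} (hp : p ∈ Set.range I) (v : E) :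
    (∀ᶠ t : ℝ in 𝓝 0, p + t • v ∈ Set.range I) ↔ ∀ i, c p i = 0 → c v i = 0 := by
  rw [hI] at hp ⊢
  constructor
  · intro h i hi
    have h' : ∀ᶠ t : ℝ in 𝓝 0, p + (-t) • v ∈ {e | ∀ i, 0 ≤ c e i} := by
      have : Filter.Tendsto (fun t : ℝ => -t) (𝓝 0) (𝓝 0) := by
        simpa using (continuous_neg (G := ℝ)).tendsto 0
      exact this.eventually h
    obtain ⟨ε, hε, hball⟩ := Metric.eventually_nhds_iff.1 (h.and h')
    have h2 := @hball (ε / 2) (by simp [abs_of_pos hε, hε])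
    have h3 := h2.1 i
    have h4 := h2.2 i
    simp only [map_add, map_smul, Pi.add_apply, Pi.smul_apply, hi, smul_eq_mul, zero_add] at h3 h4
    nlinarith
  · intro h
    simp only [Set.mem_ofPred_eq, Filter.eventually_all]
    intro i
    by_cases hi : c p i = 0
    · filter_upwards with t
      simp [hi, h i hi]
    · have h0 : 0 < c p i := lt_of_le_of_ne (hp i) (Ne.symm hi)
      have hc : Continuous fun t : ℝ => c (p + t • v) i := by fun_prop
      have : ∀ᶠ t in 𝓝 (0 : ℝ), 0 < c (p + t • v) i :=
        hc.continuousAt.eventually_mem (Ioi_mem_nhds (by simpa using h0))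
      exact this.mono fun t ht => ht.le

theorem span_eventually_add_smul_mem_range (c : E →L[ℝ] (ι → ℝ))
    (hI : Set.range I = {e | ∀ i, 0 ≤ c e i}) {p : E} (hp : p ∈ Set.range I) :
    Submodule.span ℝ {v : E | ∀ᶠ t : ℝ in 𝓝 0, p + t • v ∈ Set.range I} =
      LinearMap.ker (LinearMap.funLeft ℝ ℝ (Subtype.val : {i // c p i = 0} → ι) ∘ₗ
        c.toLinearMap) := by
  refine Eq.trans ?_ (Submodule.span_eq _)
  congr 1
  ext v
  rw [Set.mem_ofPred_eq, eventually_add_smul_mem_range_iff c hI hp]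
  simp [funext_iff, LinearMap.funLeft]

theorem mem_span_iff (c : E →L[ℝ] (ι → ℝ))
    (hI : Set.range I = {e | ∀ i, 0 ≤ c e i}) {p : E} (hp : p ∈ Set.range I) (v : E) :
    v ∈ Submodule.span ℝ {v : E | ∀ᶠ t : ℝ in 𝓝 0, p + t • v ∈ Set.range I} ↔
      ∀ i, c p i = 0 → c v i = 0 := by
  rw [span_eventually_add_smul_mem_range c hI hp, LinearMap.mem_ker, funext_iff]
  simp [LinearMap.funLeft]

theorem extChartAt_self_mem_range (x : M) : extChartAt I x x ∈ Set.range I :=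
  extChartAt_target_subset_range x (mem_extChartAt_target x)

theorem mem_faceTangent_iff (c : E →L[ℝ] (ι → ℝ))
    (hI : Set.range I = {e | ∀ i, 0 ≤ c e i}) (x : M) (v : TangentSpace I x) :
    v ∈ faceTangent I x ↔ ∀ i, c (extChartAt I x x) i = 0 → c (show E from v) i = 0 := by
  exact mem_span_iff c hI (extChartAt_self_mem_range x) v

theorem finrank_span_add_ncard [FiniteDimensional ℝ E] (c : E →L[ℝ] (ι → ℝ))
    (hc : Function.Surjective c) (hI : Set.range I = {e | ∀ i, 0 ≤ c e i}) {p : E}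
    (hp : p ∈ Set.range I) :
    {i | c p i = 0}.ncard + Module.finrank ℝ (Submodule.span ℝ
      {v : E | ∀ᶠ t : ℝ in 𝓝 0, p + t • v ∈ Set.range I}) = Module.finrank ℝ E := by
  classical
  have := Fintype.ofFinite ι
  let S : Type _ := {i // c p i = 0}
  let L : E →ₗ[ℝ] (S → ℝ) := LinearMap.funLeft ℝ ℝ (Subtype.val : S → ι) ∘ₗ c.toLinearMap
  have hL : Function.Surjective L :=
    (LinearMap.funLeft_surjective_of_injective ℝ ℝ _ Subtype.val_injective).comp hc
  have h1 := L.finrank_range_add_finrank_ker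
  rw [LinearMap.range_eq_top.2 hL, finrank_top, Module.finrank_fintype_fun_eq_card,
    ← span_eventually_add_smul_mem_range c hI hp] at h1
  have h2 : {i | c p i = 0}.ncard = Fintype.card S := by
    rw [← Nat.card_coe_set_eq, ← Nat.card_eq_fintype_card]; rfl
  rw [h2, h1]

theorem depth_eq_ncard [FiniteDimensional ℝ E] (c : E →L[ℝ] (ι → ℝ)) (hc : Function.Surjective c)
    (hI : Set.range I = {e | ∀ i, 0 ≤ c e i}) (x : M) :
    depth I x = {i | c (extChartAt I x x) i = 0}.ncard :=
  (Nat.eq_sub_of_add_eq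
    (finrank_span_add_ncard c hc hI (extChartAt_self_mem_range (I := I) x))).symm

/-- The differential of the coordinate change is injective and carries the face directions of one
chart into those of the other, so dimensions compare. Exchanging the charts turns the inequality
into equality. -/
theorem ncard_zeros_extChartAt_le [IsManifold I ∞ M] [FiniteDimensional ℝ E]
    (c : E →L[ℝ] (ι → ℝ)) (hc : Function.Surjective c)
    (hI : Set.range I = {e | ∀ i, 0 ≤ c e i}) {x x' z : M} (hx : z ∈ (extChartAt I x).source)
    (hx' : z ∈ (extChartAt I x').source) :
    {i | c (extChartAt I x' z) i = 0}.ncard ≤ {i | c (extChartAt I x z) i = 0}.ncard := by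
  have : IsManifold I 1 M := IsManifold.of_le (n := ∞) (by norm_cast)
  have hmem : ∀ y w : M, extChartAt I y w ∈ Set.range I := fun y w => ⟨_, rfl⟩
  have h1 := finrank_span_add_ncard c hc hI (hmem x z)
  have h2 := finrank_span_add_ncard c hc hI (hmem x' z)
  let T := (tangentCoordChange I x x' z).toLinearMap
  have hT : Function.Injective T := by
    intro v w h
    have := congrArg (tangentCoordChange I x' x z) h
    change tangentCoordChange I x' x z (tangentCoordChange I x x' z v) =
      tangentCoordChange I x' x z (tangentCoordChange I x x' z w) at this
    rwa [tangentCoordChange_comp ⟨⟨hx, hx'⟩, hx⟩, tangentCoordChange_comp ⟨⟨hx, hx'⟩, hx⟩,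
      tangentCoordChange_self hx, tangentCoordChange_self hx] at this
  have hD := hasFDerivWithinAt_tangentCoordChange (I := I) ⟨hx, hx'⟩
  have hle : (Submodule.span ℝ
      {v : E | ∀ᶠ t : ℝ in 𝓝 0, extChartAt I x z + t • v ∈ Set.range I}).map T ≤
      Submodule.span ℝ {v : E | ∀ᶠ t : ℝ in 𝓝 0, extChartAt I x' z + t • v ∈ Set.range I} := by
    rw [Submodule.map_span]
    refine Submodule.span_mono ?_
    rintro _ ⟨v, hv, rfl⟩
    rw [Set.mem_ofPred_eq, eventually_add_smul_mem_range_iff c hI (hmem x' z)]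
    intro i hi
    have hline : HasDerivAt (fun t : ℝ => extChartAt I x z + t • v) v 0 := by
      simpa using ((hasDerivAt_id (0 : ℝ)).smul_const v).const_add (extChartAt I x z)
    have hD' : HasFDerivWithinAt ((extChartAt I x') ∘ (extChartAt I x).symm)
        (tangentCoordChange I x x' z) (Set.range I) (extChartAt I x z + (0 : ℝ) • v) := by
      simpa using hD
    have hcurve := hD'.comp_hasDerivAt (0 : ℝ) hline hv
    have hci := ((ContinuousLinearMap.proj (R := ℝ) (φ := fun _ : ι => ℝ) i).comp c).hasFDerivAt.comp_hasDerivAt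
      (0 : ℝ) hcurve
    -- Chart values always lie in `range I`, even off the chart's source, so this coordinate is
    -- nonnegative for every `t` and zero at `t = 0`.
    have hmin : IsLocalMin (fun t : ℝ => c ((extChartAt I x' ∘ (extChartAt I x).symm)
        (extChartAt I x z + t • v)) i) 0 := by
      refine Filter.Eventually.of_forall fun t => ?_
      simp only [zero_smul, add_zero, Function.comp_apply, (extChartAt I x).left_inv hx, hi]
      have := hmem x' ((extChartAt I x).symm (extChartAt I x z + t • v))
      rw [hI] at this
      exact this i
    exact hmin.hasDerivAt_eq_zero hci
  have h3 := Submodule.finrank_mono hle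
  rw [← (Submodule.equivMapOfInjective T hT _).finrank_eq] at h3
  omega

/-- The depth can be computed in every preferred chart. -/
theorem depth_eq_ncard_of_mem_source [IsManifold I ∞ M] [FiniteDimensional ℝ E]
    (c : E →L[ℝ] (ι → ℝ)) (hc : Function.Surjective c)
    (hI : Set.range I = {e | ∀ i, 0 ≤ c e i}) {x y : M} (hy : y ∈ (extChartAt I x).source) :
    depth I y = {i | c (extChartAt I x y) i = 0}.ncard := by
  rw [depth_eq_ncard c hc hI]
  exact le_antisymm (ncard_zeros_extChartAt_le c hc hI hy (mem_extChartAt_source y))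
    (ncard_zeros_extChartAt_le c hc hI (mem_extChartAt_source y) hy)

/-- Meant for open subsets of `X_0`, where one global chart makes the coordinates restrictions of
linear maps. -/
theorem hasMFDerivAt_of_eq_comp_extChartAt {F : Type*} [NormedAddCommGroup F] [NormedSpace ℝ F]
    {f : M → F} {L : E →L[ℝ] F} {x : M} (h : ∀ y, f y = L (extChartAt I x y)) :
    HasMFDerivAt I 𝓘(ℝ, F) f x L := by
  have hf : f = L ∘ extChartAt I x := funext h
  refine ⟨hf ▸ L.continuous.continuousAt.comp (continuousAt_extChartAt x), ?_⟩
  have : HasFDerivWithinAt L L (Set.range I) (extChartAt I x x) := L.hasFDerivWithinAt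
  refine this.congr_of_eventuallyEq ?_ ?_
  · filter_upwards [extChartAt_target_mem_nhdsWithin x] with y hy
    rw [writtenInExtChartAt, extChartAt_model_space_eq_id]
    change f _ = _
    rw [h, (extChartAt I x).right_inv hy]
  · rw [writtenInExtChartAt, extChartAt_model_space_eq_id]
    change f _ = _
    rw [h, (extChartAt I x).right_inv (mem_extChartAt_target x)]

end FaceTangent

/-! ### Connectedness and locally constant data -/

section Connected

variable {X : Type*} [TopologicalSpace X]

/-- A subset of a preconnected set `K` that is dense in `K` and locally, near every point of `K`,
preconnected is itself preconnected. -/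
theorem isPreconnected_of_locally {K D : Set X} (hK : IsPreconnected K) (hDK : D ⊆ K)
    (hcl : K ⊆ closure D) (hloc : ∀ x ∈ K, ∃ U ∈ 𝓝 x, IsPreconnected (D ∩ U)) :
    IsPreconnected D := by
  rw [isPreconnected_iff_subset_of_disjoint]
  intro u v hu hv hDuv hdisj
  -- Label a point of `K` by which of `u`, `v` contains `D` near it. Each label is an open
  -- condition, and density of `D` in `K` excludes having both, so connectedness of `K` leaves a
  -- single label.
  have key : ∀ x ∈ K, ∃ U ∈ 𝓝 x, D ∩ U ⊆ u ∨ D ∩ U ⊆ v := by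
    intro x hx
    obtain ⟨U, hU, hUc⟩ := hloc x hx
    refine ⟨U, hU, isPreconnected_iff_subset_of_disjoint.1 hUc u v hu hv
      (Set.inter_subset_left.trans hDuv) ?_⟩
    rw [← Set.subset_empty_iff, ← hdisj]
    exact Set.inter_subset_inter_left _ Set.inter_subset_left
  let u' : Set X := interior {x | ∃ U ∈ 𝓝 x, D ∩ U ⊆ u}
  let v' : Set X := interior {x | ∃ U ∈ 𝓝 x, D ∩ U ⊆ v}
  have hopen : ∀ w : Set X, IsOpen {x | ∃ U ∈ 𝓝 x, D ∩ U ⊆ w} := by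
    intro w
    rw [isOpen_iff_mem_nhds]
    rintro x ⟨U, hU, hUw⟩
    filter_upwards [eventually_mem_nhds_iff.2 hU] with y hy
    exact ⟨U, hy, hUw⟩
  have h := isPreconnected_iff_subset_of_disjoint.1 hK _ _ (hopen u) (hopen v)
    (fun x hx => by
      obtain ⟨U, hU, h | h⟩ := key x hx
      · exact Or.inl ⟨U, hU, h⟩
      · exact Or.inr ⟨U, hU, h⟩)
    (by
      rw [Set.eq_empty_iff_forall_notMem]
      rintro x ⟨hx, ⟨U, hU, hUu⟩, ⟨V, hV, hVv⟩⟩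
      obtain ⟨y, hy, hyD⟩ := mem_closure_iff_nhds.1 (hcl hx) _ (Filter.inter_mem hU hV)
      have : y ∈ D ∩ (u ∩ v) := ⟨hyD, hUu ⟨hyD, hy.1⟩, hVv ⟨hyD, hy.2⟩⟩
      rw [hdisj] at this
      exact this)
  have hmem : ∀ w : Set X, K ⊆ {x | ∃ U ∈ 𝓝 x, D ∩ U ⊆ w} → D ⊆ w := by
    intro w hw x hx
    obtain ⟨U, hU, hUw⟩ := hw (hDK hx)
    exact hUw ⟨hx, mem_of_mem_nhds hU⟩
  exact h.imp (hmem u) (hmem v)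

/-- A function with values in the integers is constant on preconnected sets. -/
theorem eq_of_isPreconnected_of_int {K : Set X} (hK : IsPreconnected K) {f : X → ℝ}
    (hf : ContinuousOn f K) (hint : ∀ x ∈ K, ∃ m : ℤ, f x = m) {x y : X} (hx : x ∈ K)
    (hy : y ∈ K) : f x = f y := by
  have := (hK.image f hf).constant_of_mapsTo (T := Set.range ((↑) : ℤ → ℝ)) (f := id)
  by_contra hne
  have hord := (hK.image f hf).ordConnected
  obtain ⟨a, ha⟩ := hint x hx
  obtain ⟨b, hb⟩ := hint y hy
  have hab : a ≠ b := fun h => hne (by rw [ha, hb, h])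
  have aux : ∀ (x y : X) (a b : ℤ), x ∈ K → y ∈ K → f x = a → f y = b → a < b → False := by
    intro x y a b hx hy ha hb hab
    have hab' : (a : ℝ) + 1 ≤ b := by exact_mod_cast hab
    -- By the intermediate value property `a + 1/2` would be a value of `f`, hence an integer.
    obtain ⟨z, hz, hfz⟩ := hord.out ⟨x, hx, rfl⟩ ⟨y, hy, rfl⟩
      (show (a : ℝ) + 1 / 2 ∈ Set.Icc (f x) (f y) by rw [ha, hb]; constructor <;> linarith)
    obtain ⟨m, hm⟩ := hint z hz
    rw [hm] at hfz
    have h1 : (2 * m : ℤ) = 2 * a + 1 := by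
      have : (2 * m : ℝ) = 2 * a + 1 := by linarith
      exact_mod_cast this
    omega
  rcases lt_or_gt_of_ne hab with h | h
  · exact aux x y a b hx hy ha hb h
  · exact aux y x b a hy hx hb ha h

/-- An upper semicontinuous family of finite sets of constant cardinality is constant on preconnected
sets. -/
theorem _root_.IsPreconnected.eq_of_ncard_eq {ι : Type*} [Finite ι] {K : Set X}
    (hK : IsPreconnected K) {Z : X → Set ι} (hZ : ∀ x ∈ K, ∀ᶠ y in 𝓝 x, Z y ⊆ Z x) {k : ℕ}
    (hk : ∀ x ∈ K, (Z x).ncard = k) {x y : X} (hx : x ∈ K) (hy : y ∈ K) : Z x = Z y := by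
  let _ : TopologicalSpace (Set ι) := ⊥
  have : DiscreteTopology (Set ι) := ⟨rfl⟩
  refine hK.constant (f := Z) (fun z hz => ?_) hx hy
  refine tendsto_const_nhds.congr' ?_
  filter_upwards [mem_nhdsWithin_of_mem_nhds (hZ z hz), self_mem_nhdsWithin] with w hw hwK
  exact (Set.eq_of_subset_of_ncard_le hw (by rw [hk z hz, hk w hwK])).symm

end Connected

local notation "𝓠" => modelWithCornersEuclideanQuadrant

/-! ### Chart boxes and their strata -/

section Quadrant

variable {n : ℕ} {M : Type*} [TopologicalSpace M] [ChartedSpace (EuclideanQuadrant n) M]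

theorem range_quadrant (n : ℕ) :
    Set.range (𝓠 n) = {e | ∀ i, 0 ≤ EuclideanSpace.equiv (Fin n) ℝ e i} :=
  range_euclideanQuadrant n

theorem mem_range_quadrant {e : EuclideanSpace ℝ (Fin n)} :
    e ∈ Set.range (𝓠 n) ↔ ∀ i, 0 ≤ e i := by
  rw [range_quadrant]; rfl

theorem extChartAt_quadrant_nonneg (x y : M) (i : Fin n) : 0 ≤ extChartAt (𝓠 n) x y i :=
  mem_range_quadrant.1 ⟨_, rfl⟩ i

theorem depth_quadrant [IsManifold (𝓠 n) ∞ M] {x y : M} (hy : y ∈ (extChartAt (𝓠 n) x).source) :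
    depth (𝓠 n) y = {i | extChartAt (𝓠 n) x y i = 0}.ncard :=
  depth_eq_ncard_of_mem_source (EuclideanSpace.equiv (Fin n) ℝ).toContinuousLinearMap
    (EuclideanSpace.equiv (Fin n) ℝ).surjective (range_quadrant n) hy

/-- A convex open set `B` of the model space such that the chart at `x` identifies a neighbourhood
of `x` with the part of the quadrant in `B`. -/
structure IsChartBox (x : M) (B : Set (EuclideanSpace ℝ (Fin n))) : Prop where
  convex : Convex ℝ B
  isOpen : IsOpen B
  mem : extChartAt (𝓠 n) x x ∈ B
  subset_target : B ∩ Set.range (𝓠 n) ⊆ (extChartAt (𝓠 n) x).target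
  zero_of_zero : ∀ e ∈ B, ∀ i, e i = 0 → extChartAt (𝓠 n) x x i = 0

theorem exists_isChartBox (x : M) {V : Set M} (hV : V ∈ 𝓝 x) :
    ∃ B : Set (EuclideanSpace ℝ (Fin n)), IsChartBox x B ∧
      (extChartAt (𝓠 n) x).source ∩ extChartAt (𝓠 n) x ⁻¹' B ⊆ V := by
  set p := extChartAt (𝓠 n) x x with hp
  have h1 : (extChartAt (𝓠 n) x).target ∩ (extChartAt (𝓠 n) x).symm ⁻¹' V ∈
      𝓝[Set.range (𝓠 n)] p :=
    Filter.inter_mem (extChartAt_target_mem_nhdsWithin x) 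
      (mem_nhdsWithin_of_mem_nhds (extChartAt_preimage_mem_nhds hV))
  obtain ⟨ε, hε, h1⟩ := Metric.mem_nhdsWithin_iff.1 h1
  have h2 : ∀ᶠ e in 𝓝 p, ∀ i, e i = 0 → p i = 0 := by
    rw [Filter.eventually_all]
    intro i
    by_cases hi : p i = 0
    · simp [hi]
    · have : Continuous fun e : EuclideanSpace ℝ (Fin n) => e i := by fun_prop
      filter_upwards [this.continuousAt.eventually_ne hi] with e he h0
      exact absurd h0 he
  obtain ⟨δ, hδ, h2⟩ := Metric.eventually_nhds_iff_ball.1 h2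
  have hε' : Metric.ball p (min ε δ) ⊆ Metric.ball p ε := Metric.ball_subset_ball (min_le_left _ _)
  have hδ' : Metric.ball p (min ε δ) ⊆ Metric.ball p δ := Metric.ball_subset_ball (min_le_right _ _)
  refine ⟨Metric.ball p (min ε δ), ⟨convex_ball _ _, Metric.isOpen_ball,
    Metric.mem_ball_self (lt_min hε hδ), fun e he => (h1 ⟨hε' he.1, he.2⟩).1,
    fun e he => h2 e (hδ' he)⟩, ?_⟩
  rintro y ⟨hy, hyB⟩
  have := (h1 ⟨hε' hyB, ⟨_, rfl⟩⟩).2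
  rwa [Set.mem_preimage, (extChartAt (𝓠 n) x).left_inv hy] at this

/-- The points of a chart box at `x` at which exactly the coordinates in `T` vanish. -/
def stratum (x : M) (B : Set (EuclideanSpace ℝ (Fin n))) (T : Set (Fin n)) : Set M :=
  {y | y ∈ (extChartAt (𝓠 n) x).source ∧ extChartAt (𝓠 n) x y ∈ B ∧
    ∀ k, extChartAt (𝓠 n) x y k = 0 ↔ k ∈ T}

namespace IsChartBox

variable {x : M} {B : Set (EuclideanSpace ℝ (Fin n))}

theorem mem_nhds (hB : IsChartBox x B) {y : M} (hy : y ∈ (extChartAt (𝓠 n) x).source)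
    (hyB : extChartAt (𝓠 n) x y ∈ B) :
    (extChartAt (𝓠 n) x).source ∩ extChartAt (𝓠 n) x ⁻¹' B ∈ 𝓝 y :=
  Filter.inter_mem ((isOpen_extChartAt_source x).mem_nhds hy)
    ((continuousAt_extChartAt' hy).preimage_mem_nhds (hB.isOpen.mem_nhds hyB))

/-- The stratum corresponds in the chart to a convex set, since convex combinations keep zero
coordinates zero and positive ones positive. -/
theorem isPreconnected_stratum (hB : IsChartBox x B) (T : Set (Fin n)) :
    IsPreconnected (stratum x B T) := by
  have hconv : Convex ℝ {e : EuclideanSpace ℝ (Fin n) | e ∈ B ∧ e ∈ Set.range (𝓠 n) ∧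
      ∀ k, e k = 0 ↔ k ∈ T} := by
    rintro e ⟨he, he', heT⟩ f ⟨hf, hf', hfT⟩ a b ha hb hab
    rw [mem_range_quadrant] at he' hf'
    refine ⟨hB.convex he hf ha hb hab, mem_range_quadrant.2 fun k => ?_, fun k => ?_⟩
    · have := he' k; have := hf' k
      simp only [PiLp.add_apply, PiLp.smul_apply, smul_eq_mul]
      positivity
    · simp only [PiLp.add_apply, PiLp.smul_apply, smul_eq_mul]
      by_cases hk : k ∈ T
      · simp [(heT k).2 hk, (hfT k).2 hk, hk]
      · have h1 : 0 < e k := lt_of_le_of_ne (he' k) fun h => hk ((heT k).1 h.symm)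
        have h2 : 0 < f k := lt_of_le_of_ne (hf' k) fun h => hk ((hfT k).1 h.symm)
        have : 0 < a * e k + b * f k := by
          rcases ha.eq_or_lt with rfl | ha
          · have : b = 1 := by linarith
            subst this; linarith
          · positivity
        simp [this.ne', hk]
  have himg : stratum x B T = (extChartAt (𝓠 n) x).symm '' {e | e ∈ B ∧ e ∈ Set.range (𝓠 n) ∧
      ∀ k, e k = 0 ↔ k ∈ T} := by
    ext y
    constructor
    · rintro ⟨hy, hyB, hyT⟩
      exact ⟨_, ⟨hyB, ⟨_, rfl⟩, hyT⟩, (extChartAt (𝓠 n) x).left_inv hy⟩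
    · rintro ⟨e, ⟨heB, her, heT⟩, rfl⟩
      have ht := hB.subset_target ⟨heB, her⟩
      refine ⟨(extChartAt (𝓠 n) x).map_target ht, ?_, ?_⟩ <;>
        rw [(extChartAt (𝓠 n) x).right_inv ht]
      exacts [heB, heT]
  rw [himg]
  exact hconv.isPreconnected.image _ ((continuousOn_extChartAt_symm x).mono
    fun e he => hB.subset_target ⟨he.1, he.2.1⟩)

/-- Moving in the chart from `y` in a direction `w ≥ 0`. -/
theorem exists_path (hB : IsChartBox x B) {y : M} (hy : y ∈ (extChartAt (𝓠 n) x).source)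
    (hyB : extChartAt (𝓠 n) x y ∈ B) (w : EuclideanSpace ℝ (Fin n)) (hw : ∀ k, 0 ≤ w k) :
    Filter.Tendsto (fun t : ℝ => (extChartAt (𝓠 n) x).symm (extChartAt (𝓠 n) x y + t • w))
      (𝓝[≥] 0) (𝓝 y) ∧
    ∀ᶠ t : ℝ in 𝓝[≥] 0, extChartAt (𝓠 n) x y + t • w ∈ B ∩ Set.range (𝓠 n) := by
  have hc : Continuous fun t : ℝ => extChartAt (𝓠 n) x y + t • w := by fun_prop
  have hr : ∀ t : ℝ, 0 ≤ t → extChartAt (𝓠 n) x y + t • w ∈ Set.range (𝓠 n) := by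
    intro t ht
    refine mem_range_quadrant.2 fun k => ?_
    have h1 := extChartAt_quadrant_nonneg x y k
    have h2 := hw k
    simp only [PiLp.add_apply, PiLp.smul_apply, smul_eq_mul]
    positivity
  have hB' : ∀ᶠ t : ℝ in 𝓝[≥] 0, extChartAt (𝓠 n) x y + t • w ∈ B ∩ Set.range (𝓠 n) := by
    have : ∀ᶠ t : ℝ in 𝓝 0, extChartAt (𝓠 n) x y + t • w ∈ B :=
      hc.continuousAt.eventually_mem (hB.isOpen.mem_nhds (by simpa using hyB))
    filter_upwards [mem_nhdsWithin_of_mem_nhds this, self_mem_nhdsWithin] with t h1 h2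
    exact ⟨h1, hr t h2⟩
  refine ⟨?_, hB'⟩
  have hs := (continuousOn_extChartAt_symm (I := 𝓠 n) x) (extChartAt (𝓠 n) x y)
    ((extChartAt (𝓠 n) x).map_source hy)
  have ht : Filter.Tendsto (fun t : ℝ => extChartAt (𝓠 n) x y + t • w) (𝓝[≥] 0)
      (𝓝[(extChartAt (𝓠 n) x).target] (extChartAt (𝓠 n) x y)) := by
    refine tendsto_nhdsWithin_iff.2 ⟨?_, hB'.mono fun t h => hB.subset_target h⟩
    have := hc.tendsto 0
    simp only [zero_smul, add_zero] at this
    exact this.mono_left nhdsWithin_le_nhds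
  have := hs.tendsto.comp ht
  rwa [(extChartAt (𝓠 n) x).left_inv hy] at this

/-- Raising all coordinates outside `T` by a small `t > 0` makes exactly those in `T` vanish. -/
theorem mem_closure_stratum (hB : IsChartBox x B) {y : M}
    (hy : y ∈ (extChartAt (𝓠 n) x).source) (hyB : extChartAt (𝓠 n) x y ∈ B) {T : Set (Fin n)}
    (hT : ∀ k ∈ T, extChartAt (𝓠 n) x y k = 0) : y ∈ closure (stratum x B T) := by
  classical
  let w : EuclideanSpace ℝ (Fin n) := WithLp.toLp 2 fun k => if k ∈ T then 0 else 1
  have hw : ∀ k, 0 ≤ w k := fun k => by by_cases hk : k ∈ T <;> simp [w, hk]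
  obtain ⟨h1, h2⟩ := hB.exists_path hy hyB w hw
  have hle : 𝓝[>] (0 : ℝ) ≤ 𝓝[≥] 0 := nhdsWithin_mono _ Set.Ioi_subset_Ici_self
  refine mem_closure_of_tendsto (h1.mono_left hle) ?_
  filter_upwards [h2.filter_mono hle, self_mem_nhdsWithin] with t ht ht0
  have ht' := hB.subset_target ht
  refine ⟨(extChartAt (𝓠 n) x).map_target ht', ?_, fun k => ?_⟩ <;>
    rw [(extChartAt (𝓠 n) x).right_inv ht']
  · exact ht.1
  · have := extChartAt_quadrant_nonneg x y k
    have ht0 : 0 < t := ht0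
    by_cases hk : k ∈ T
    · simpa [w, hk] using hT k hk
    · have : extChartAt (𝓠 n) x y k + t ≠ 0 := by positivity
      simpa [w, hk] using this

theorem depth_of_mem_stratum [IsManifold (𝓠 n) ∞ M] {T : Set (Fin n)} {y : M}
    (hy : y ∈ stratum x B T) : depth (𝓠 n) y = T.ncard := by
  rw [depth_quadrant hy.1]
  congr 1
  ext k
  exact hy.2.2 k

/-- If `ρ` vanishes where the chart coordinate `i` vanishes, then its differential kills the other
coordinate directions. -/
theorem mfderiv_single_eq_zero (hB : IsChartBox x B) {ρ : M → ℝ}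
    (hρ : MDifferentiableAt (𝓠 n) 𝓘(ℝ, ℝ) ρ x) {i : Fin n} (hi : extChartAt (𝓠 n) x x i = 0)
    (h : ∀ y ∈ (extChartAt (𝓠 n) x).source, extChartAt (𝓠 n) x y ∈ B →
      extChartAt (𝓠 n) x y i = 0 → ρ y = 0) {k : Fin n} (hk : k ≠ i) :
    (mfderiv (𝓠 n) 𝓘(ℝ, ℝ) ρ x : EuclideanSpace ℝ (Fin n) →L[ℝ] ℝ)
      (EuclideanSpace.single k 1) = 0 := by
  classical
  set w : EuclideanSpace ℝ (Fin n) := EuclideanSpace.single k 1 with hw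
  have hw0 : ∀ k, 0 ≤ w k := fun l => by
    by_cases hl : l = k <;> simp [w, hl]
  have hD := hρ.hasMFDerivAt.2
  set p := extChartAt (𝓠 n) x x with hp
  obtain ⟨-, h2⟩ := hB.exists_path (mem_extChartAt_source x) hB.mem w hw0
  have hline : HasDerivWithinAt (fun t : ℝ => p + t • w) w (Set.Ici 0) 0 := by
    simpa using (((hasDerivAt_id (0 : ℝ)).smul_const w).const_add p).hasDerivWithinAt
  have hmaps : Set.MapsTo (fun t : ℝ => p + t • w) (Set.Ici 0) (Set.range (𝓠 n)) := by
    intro t ht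
    have ht : 0 ≤ t := ht
    refine mem_range_quadrant.2 fun l => ?_
    have h1 := extChartAt_quadrant_nonneg x x l
    have h2 := hw0 l
    simp only [PiLp.add_apply, PiLp.smul_apply, smul_eq_mul]
    positivity
  have hD' : HasFDerivWithinAt (writtenInExtChartAt (𝓠 n) 𝓘(ℝ, ℝ) x ρ)
      (mfderiv (𝓠 n) 𝓘(ℝ, ℝ) ρ x : EuclideanSpace ℝ (Fin n) →L[ℝ] ℝ) (Set.range (𝓠 n))
      (p + (0 : ℝ) • w) := by
    simpa using hD
  -- The line may leave the quadrant for `t < 0`, so only one-sided derivatives are compared.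
  have hcomp := hD'.comp_hasDerivWithinAt (0 : ℝ) hline hmaps
  have hzero : HasDerivWithinAt (writtenInExtChartAt (𝓠 n) 𝓘(ℝ, ℝ) x ρ ∘ fun t : ℝ => p + t • w)
      0 (Set.Ici 0) 0 := by
    have hev : ∀ᶠ t : ℝ in 𝓝[≥] 0,
        (writtenInExtChartAt (𝓠 n) 𝓘(ℝ, ℝ) x ρ ∘ fun t : ℝ => p + t • w) t = 0 := by
      filter_upwards [h2] with t ht
      have ht' := hB.subset_target ht
      rw [writtenInExtChartAt, extChartAt_model_space_eq_id]
      refine h _ ((extChartAt (𝓠 n) x).map_target ht') ?_ ?_ <;>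
        rw [(extChartAt (𝓠 n) x).right_inv ht']
      · exact ht.1
      · simp only [PiLp.add_apply, PiLp.smul_apply, smul_eq_mul, w]
        rw [← hp, hi]
        simp [hk.symm]
    exact (hasDerivWithinAt_const (0 : ℝ) (Set.Ici (0 : ℝ)) (0 : ℝ)).congr_of_eventuallyEq hev
      (hev.self_of_nhdsWithin (Set.mem_Ici.2 le_rfl))
  exact UniqueDiffWithinAt.eq_deriv (F := ℝ) _ (uniqueDiffWithinAt_Ici (0 : ℝ)) hcomp hzero

end IsChartBox

end Quadrant

/-! ### Hyperfaces and open faces of `M` -/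

namespace Choices

variable {n : ℕ} {M : Type*} [TopologicalSpace M] [ChartedSpace (EuclideanQuadrant n) M]
  (D : Choices n M)

theorem isHyperface (j : Fin D.r) : IsHyperface (𝓠 n) (D.A j) := by
  have : D.A j ∈ Set.range D.A := ⟨j, rfl⟩
  rwa [D.range_A] at this

theorem isClosed_A (j : Fin D.r) : IsClosed (D.A j) := by
  obtain ⟨F, -, h⟩ := D.isHyperface j
  exact h ▸ isClosed_closure

/-- The set of (indices of) hyperfaces through `x`. -/
def hyperfacesAt (x : M) : Set (Fin D.r) := {j | x ∈ D.A j}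

theorem mem_interFace {J : Finset (Fin D.r)} {x : M} :
    x ∈ interFace D.A J ↔ (J : Set (Fin D.r)) ⊆ D.hyperfacesAt x := by
  simp [interFace, hyperfacesAt, Set.subset_def]

theorem eventually_hyperfacesAt_subset (x : M) :
    ∀ᶠ y in 𝓝 x, D.hyperfacesAt y ⊆ D.hyperfacesAt x := by
  have : ∀ᶠ y in 𝓝 x, ∀ j, y ∈ D.A j → x ∈ D.A j := by
    rw [Filter.eventually_all]
    intro j
    by_cases hj : x ∈ D.A j
    · simp [hj]
    · filter_upwards [(D.isClosed_A j).isOpen_compl.mem_nhds hj] with y hy hy'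
      exact absurd hy' hy
  exact this

/-- In a chart box at `x`, the hyperfaces of the manifold are the coordinate hyperplanes. -/
theorem exists_coordinate_hyperfaces [IsManifold (𝓠 n) ∞ M] {x : M} {B : Set (EuclideanSpace ℝ (Fin n))}
    (hB : IsChartBox x B) :
    ∃ a : {i // extChartAt (𝓠 n) x x i = 0} → Fin D.r, Function.Injective a ∧
      (∀ i, ∀ k ≠ i.1, (mfderiv (𝓠 n) 𝓘(ℝ, ℝ) (D.ρ (a i)) x : EuclideanSpace ℝ (Fin n) →L[ℝ] ℝ)
        (EuclideanSpace.single k 1) = 0) ∧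
      ∀ y ∈ (extChartAt (𝓠 n) x).source, extChartAt (𝓠 n) x y ∈ B → ∀ j, y ∈ D.A j ↔
        ∃ i, extChartAt (𝓠 n) x y i.1 = 0 ∧ a i = j := by
  classical
  set p := extChartAt (𝓠 n) x x with hp
  have hdepth : ∀ i : Fin n, ∀ y ∈ stratum x B {i}, depth (𝓠 n) y = 1 := fun i y hy => by
    rw [IsChartBox.depth_of_mem_stratum hy, Set.ncard_singleton]
  -- The points of the box where only coordinate `i` vanishes have depth one and form a connected
  -- set, so they lie in one open face of codimension one, whose closure is the hyperface `a i`.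
  have hex : ∀ i : {i // p i = 0}, ∃ (j : Fin D.r) (q : M), q ∈ stratum x B {i.1} ∧
      D.A j = closure (connectedComponentIn {y : M | depth (𝓠 n) y = 1} q) := by
    intro i
    have hx : x ∈ closure (stratum x B {i.1}) :=
      hB.mem_closure_stratum (mem_extChartAt_source x) hB.mem (by rintro k rfl; exact i.2)
    obtain ⟨q, hq⟩ := closure_nonempty_iff.1 ⟨x, hx⟩
    have : closure (connectedComponentIn {y : M | depth (𝓠 n) y = 1} q) ∈ Set.range D.A := by
      rw [D.range_A]
      exact ⟨_, ⟨q, hdepth _ q hq, rfl⟩, rfl⟩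
    obtain ⟨j, hj⟩ := this
    exact ⟨j, q, hq, hj⟩
  choose a q hq ha using hex
  have hsub : ∀ i, stratum x B {i.1} ⊆ connectedComponentIn {y : M | depth (𝓠 n) y = 1} (q i) :=
    fun i => (hB.isPreconnected_stratum _).subset_connectedComponentIn (hq i) (hdepth i.1)
  have hmem : ∀ i, ∀ y ∈ (extChartAt (𝓠 n) x).source, extChartAt (𝓠 n) x y ∈ B →
      extChartAt (𝓠 n) x y i.1 = 0 → y ∈ D.A (a i) := by
    intro i y hy hyB hyi
    rw [ha i]
    refine closure_mono (hsub i) (hB.mem_closure_stratum hy hyB ?_)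
    rintro k rfl
    exact hyi
  have hderiv : ∀ i, ∀ k ≠ i.1,
      (mfderiv (𝓠 n) 𝓘(ℝ, ℝ) (D.ρ (a i)) x : EuclideanSpace ℝ (Fin n) →L[ℝ] ℝ)
        (EuclideanSpace.single k 1) = 0 := by
    intro i k hk
    refine hB.mfderiv_single_eq_zero
      ((D.ρ_defining (a i)).smooth.mdifferentiableAt (by simp)) i.2 ?_ hk
    exact fun y hy hyB hyi => ((D.ρ_defining (a i)).zero_iff y).2 (hmem i y hy hyB hyi)
  refine ⟨a, ?_, hderiv, fun y hy hyB j => ⟨fun hyj => ?_, ?_⟩⟩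
  -- If `a i = a i'` with `i ≠ i'`, the differential of that defining function kills every basis
  -- vector.
  · intro i i' hii
    by_contra hne
    have hx : x ∈ D.A (a i) := hmem i x (mem_extChartAt_source x) hB.mem i.2
    refine (D.ρ_defining (a i)).deriv_ne_zero x hx ?_
    have h : (mfderiv (𝓠 n) 𝓘(ℝ, ℝ) (D.ρ (a i)) x : EuclideanSpace ℝ (Fin n) →L[ℝ] ℝ) = 0 := by
      refine ContinuousLinearMap.coe_injective
        ((EuclideanSpace.basisFun (Fin n) ℝ).toBasis.ext fun k => ?_)
      simp only [OrthonormalBasis.coe_toBasis, EuclideanSpace.basisFun_apply]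
      by_cases hk : k = i.1
      · have hk' : k ≠ i'.1 := fun h => hne (Subtype.ext (hk.symm.trans h))
        have := hderiv i' k hk'
        rw [← hii] at this
        exact this
      · exact hderiv i k hk
    exact h
  · obtain ⟨F, ⟨z, hz, rfl⟩, hA⟩ := D.isHyperface j
    have hy' : y ∈ closure (connectedComponentIn {y : M | depth (𝓠 n) y = 1} z) := hA ▸ hyj
    -- In the box, the open face defining `A j` is covered by finitely many one-coordinate strata,
    -- so `y` lies in the closure of its part in one of them; that stratum identifies `j`.
    have hsub' : connectedComponentIn {y : M | depth (𝓠 n) y = 1} z ∩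
        ((extChartAt (𝓠 n) x).source ∩ extChartAt (𝓠 n) x ⁻¹' B) ⊆
        ⋃ i : {i // p i = 0}, connectedComponentIn {y : M | depth (𝓠 n) y = 1} z ∩
          stratum x B {i.1} := by
      rintro w ⟨hw, hws, hwB⟩
      have h1 : depth (𝓠 n) w = 1 :=
        connectedComponentIn_subset {y : M | depth (𝓠 n) y = 1} z hw
      rw [depth_quadrant hws] at h1
      obtain ⟨i, hi⟩ := Set.ncard_eq_one.1 h1
      have hi' : ∀ k, extChartAt (𝓠 n) x w k = 0 ↔ k ∈ ({i} : Set (Fin n)) := fun k =>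
        Set.ext_iff.1 hi k
      exact Set.mem_iUnion.2 ⟨⟨i, hB.zero_of_zero _ hwB i ((hi' i).2 rfl)⟩, hw, hws, hwB, hi'⟩
    have hcl : y ∈ closure (⋃ i : {i // p i = 0},
        connectedComponentIn {y : M | depth (𝓠 n) y = 1} z ∩ stratum x B {i.1}) := by
      refine closure_mono hsub' ?_
      rw [mem_closure_iff_nhds] at hy' ⊢
      intro t ht
      obtain ⟨w, ⟨hwt, hw⟩, hwz⟩ := hy' _ (Filter.inter_mem ht (hB.mem_nhds hy hyB))
      exact ⟨w, hwt, hwz, hw⟩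
    rw [closure_iUnion_of_finite] at hcl
    obtain ⟨i, hi⟩ := Set.mem_iUnion.1 hcl
    refine ⟨i, ?_, ?_⟩
    · obtain hi := closure_mono Set.inter_subset_right hi
      have hc : ContinuousAt (fun w => extChartAt (𝓠 n) x w i.1) y :=
        (by fun_prop : Continuous fun e : EuclideanSpace ℝ (Fin n) => e i.1).continuousAt.comp
          (continuousAt_extChartAt' hy)
      have := hc.continuousWithinAt.mem_closure (t := {0}) hi (fun w hw => (hw.2.2 i.1).2 rfl)
      simpa using this
    · obtain ⟨w, hwz, hwi⟩ := closure_nonempty_iff.1 ⟨y, hi⟩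
      apply D.A_injective
      rw [ha i, hA, connectedComponentIn_eq hwz, connectedComponentIn_eq (hsub i hwi)]
  · rintro ⟨i, hi, rfl⟩
    exact hmem i y hy hyB hi

theorem depth_eq_ncard_hyperfacesAt [IsManifold (𝓠 n) ∞ M] (x : M) : depth (𝓠 n) x = (D.hyperfacesAt x).ncard := by
  obtain ⟨B, hB, -⟩ := exists_isChartBox (n := n) x Filter.univ_mem
  obtain ⟨a, ha, -, h⟩ := D.exists_coordinate_hyperfaces hB
  rw [depth_quadrant (mem_extChartAt_source x)]
  have h1 : D.hyperfacesAt x = Set.range a := by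
    ext j
    rw [hyperfacesAt, Set.mem_ofPred_eq, h x (mem_extChartAt_source x) hB.mem]
    exact ⟨fun ⟨i, _, hi⟩ => ⟨i, hi⟩, fun ⟨i, hi⟩ => ⟨i, i.2, hi⟩⟩
  rw [h1, ← Set.image_univ, Set.ncard_image_of_injective _ ha, Set.ncard_univ]
  exact (Nat.card_coe_set_eq _).symm

/-- The differentials at `x` of the defining functions of the hyperfaces through `x` are linearly
independent: they take arbitrary values on a common tangent vector. -/
theorem exists_mfderiv_eq [IsManifold (𝓠 n) ∞ M] (x : M) (v : Fin D.r → ℝ) : ∃ ξ : EuclideanSpace ℝ (Fin n),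
    ∀ j ∈ D.hyperfacesAt x,
      (mfderiv (𝓠 n) 𝓘(ℝ, ℝ) (D.ρ j) x : EuclideanSpace ℝ (Fin n) →L[ℝ] ℝ) ξ = v j := by
  classical
  obtain ⟨B, hB, -⟩ := exists_isChartBox (n := n) x Filter.univ_mem
  obtain ⟨a, ha, hd, h⟩ := D.exists_coordinate_hyperfaces hB
  let L : Fin D.r → EuclideanSpace ℝ (Fin n) →L[ℝ] ℝ := fun j =>
    (mfderiv (𝓠 n) 𝓘(ℝ, ℝ) (D.ρ j) x : EuclideanSpace ℝ (Fin n) →L[ℝ] ℝ)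
  have hne : ∀ i, L (a i) (EuclideanSpace.single i.1 1) ≠ 0 := by
    intro i h0
    have hx : x ∈ D.A (a i) :=
      (h x (mem_extChartAt_source x) hB.mem _).2 ⟨i, i.2, rfl⟩
    refine (D.ρ_defining (a i)).deriv_ne_zero x hx ?_
    have h : L (a i) = 0 := by
      refine ContinuousLinearMap.coe_injective
        ((EuclideanSpace.basisFun (Fin n) ℝ).toBasis.ext fun k => ?_)
      simp only [OrthonormalBasis.coe_toBasis, EuclideanSpace.basisFun_apply]
      by_cases hk : k = i.1
      · exact hk ▸ h0
      · exact hd i k hk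
    exact h
  -- Each `L (a i)` is nonzero only on its own basis vector, so the system is diagonal.
  refine ⟨∑ i, (v (a i) / L (a i) (EuclideanSpace.single i.1 1)) •
    EuclideanSpace.single i.1 (1 : ℝ), fun j hj => ?_⟩
  obtain ⟨i, -, rfl⟩ := (h x (mem_extChartAt_source x) hB.mem j).1 hj
  change L (a i) _ = _
  rw [map_sum, Finset.sum_eq_single i]
  · rw [map_smul, smul_eq_mul, div_mul_cancel₀ _ (hne i)]
  · intro k _ hk
    rw [map_smul]
    have : L (a i) (EuclideanSpace.single k.1 1) = 0 := hd i k.1 fun h => hk (Subtype.ext h)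
    rw [this, smul_zero]
  · exact fun hi => absurd (Finset.mem_univ i) hi

/-- The interior of a connected component of `F_J` is connected. -/
theorem isPreconnected_interior_component [IsManifold (𝓠 n) ∞ M] (J : Finset (Fin D.r)) (x : M) :
    IsPreconnected (connectedComponentIn (interFace D.A J) x ∩
      {y | D.hyperfacesAt y = J}) ∧
    connectedComponentIn (interFace D.A J) x ⊆ closure
      (connectedComponentIn (interFace D.A J) x ∩ {y | D.hyperfacesAt y = J}) := by
  -- Near `z` the set in question is the single stratum whose vanishing coordinates are those of the
  -- hyperfaces in `J`; it is connected and has `z` in its closure.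
  have key : ∀ z ∈ connectedComponentIn (interFace D.A J) x, ∃ U ∈ 𝓝 z,
      IsPreconnected ((connectedComponentIn (interFace D.A J) x ∩ {y | D.hyperfacesAt y = J}) ∩ U) ∧
      z ∈ closure (connectedComponentIn (interFace D.A J) x ∩ {y | D.hyperfacesAt y = J}) := by
    intro z hz
    have hzJ := D.mem_interFace.1 (connectedComponentIn_subset _ _ hz)
    obtain ⟨B, hB, -⟩ := exists_isChartBox (n := n) z Filter.univ_mem
    obtain ⟨a, ha, -, h⟩ := D.exists_coordinate_hyperfaces hB
    let T : Set (Fin n) := Subtype.val '' (a ⁻¹' J)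
    have hT : ∀ i, i.1 ∈ T ↔ a i ∈ J := fun i => by
      constructor
      · rintro ⟨k, hk, hki⟩
        rwa [← Subtype.ext hki]
      · exact fun hi => ⟨i, hi, rfl⟩
    have hTz : ∀ k ∈ T, extChartAt (𝓠 n) z z k = 0 := by
      rintro _ ⟨k, -, rfl⟩
      exact k.2
    have hJ : ∀ j ∈ J, ∃ i, a i = j := fun j hj => by
      obtain ⟨i, -, hi⟩ := (h z (mem_extChartAt_source z) hB.mem j).1 (hzJ hj)
      exact ⟨i, hi⟩
    have hface : stratum z B T ⊆ {y | D.hyperfacesAt y = J} := by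
      rintro y ⟨hy, hyB, hyT⟩
      ext j
      change y ∈ D.A j ↔ j ∈ J
      rw [h y hy hyB]
      constructor
      · rintro ⟨i, hi, rfl⟩
        exact (hT i).1 ((hyT i.1).1 hi)
      · intro hj
        obtain ⟨i, rfl⟩ := hJ j hj
        exact ⟨i, (hyT i.1).2 ((hT i).2 hj), rfl⟩
    have hzcl := hB.mem_closure_stratum (mem_extChartAt_source z) hB.mem hTz
    have hsub : stratum z B T ⊆ connectedComponentIn (interFace D.A J) x := by
      -- Further hyperfaces may pass through `z`, so `z` need not lie in the stratum; adding it ties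
      -- the stratum to the component of `z`.
      have h1 : IsPreconnected (insert z (stratum z B T)) :=
        (hB.isPreconnected_stratum T).subset_closure (Set.subset_insert _ _)
          (Set.insert_subset hzcl subset_closure)
      rw [connectedComponentIn_eq hz]
      refine (Set.subset_insert z _).trans
        (h1.subset_connectedComponentIn (Set.mem_insert _ _) ?_)
      refine Set.insert_subset (connectedComponentIn_subset _ _ hz) fun y hy => ?_
      exact D.mem_interFace.2 (hface hy).ge
    refine ⟨_, hB.mem_nhds (mem_extChartAt_source z) hB.mem, ?_,
      closure_mono (Set.subset_inter hsub hface) hzcl⟩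
    convert hB.isPreconnected_stratum T using 1
    ext y
    refine ⟨?_, fun hy => ⟨⟨hsub hy, hface hy⟩, hy.1, hy.2.1⟩⟩
    rintro ⟨⟨-, hyJ⟩, hy, hyB⟩
    have hyJ' : ∀ j, y ∈ D.A j ↔ j ∈ J := fun j => Set.ext_iff.1 hyJ j
    refine ⟨hy, hyB, fun k => ⟨fun hk => ?_, ?_⟩⟩
    · let i : {i // extChartAt (𝓠 n) z z i = 0} := ⟨k, hB.zero_of_zero _ hyB k hk⟩
      exact (hT i).2 ((hyJ' _).1 ((h y hy hyB _).2 ⟨i, hk, rfl⟩))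
    · rintro ⟨i, hi, rfl⟩
      obtain ⟨i', hi', hii⟩ := (h y hy hyB _).1 ((hyJ' _).2 hi)
      rwa [← ha hii]
  have hcl := fun z hz => (key z hz).choose_spec.2.2
  refine ⟨isPreconnected_of_locally isPreconnected_connectedComponentIn Set.inter_subset_left hcl
    fun z hz => ?_, hcl⟩
  obtain ⟨U, hU, h, -⟩ := key z hz
  exact ⟨U, hU, h⟩

theorem f_eq_of_isPreconnected (J : IndexSets D.A) {K : Set M} (hK : IsPreconnected K)
    (hKJ : K ⊆ interFace D.A J.1) {x y : M} (hx : x ∈ K) (hy : y ∈ K) : D.f J x = D.f J y := by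
  refine eq_of_isPreconnected_of_int hK (D.f_smooth J).continuous.continuousOn (fun z hz => ?_)
    hx hy
  obtain ⟨k, -, -, hk⟩ := D.f_mem J z (hKJ hz)
  exact ⟨k, by simpa using hk⟩

/-- For nonempty `S` the function `f_S` alone separates components; the conditions for smaller `J`
hold automatically and match the shape of the boxes in `X_1`. For `S = ∅` this is connectedness of
`M`. -/
theorem mem_connectedComponentIn_interFace [PreconnectedSpace M] {S : Finset (Fin D.r)} {x y : M}
    (hx : x ∈ interFace D.A S) :
    y ∈ connectedComponentIn (interFace D.A S) x ↔
      y ∈ interFace D.A S ∧ ∀ J : IndexSets D.A, J.1 ⊆ S → D.f J y = D.f J x := by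
  constructor
  · intro h
    refine ⟨connectedComponentIn_subset _ _ h, fun J hJ => ?_⟩
    refine D.f_eq_of_isPreconnected J isPreconnected_connectedComponentIn
      ((connectedComponentIn_subset _ _).trans ?_) h (mem_connectedComponentIn hx)
    exact fun z hz => D.mem_interFace.2
      ((Finset.coe_subset.2 hJ).trans (D.mem_interFace.1 hz))
  · rintro ⟨hy, h⟩
    rcases S.eq_empty_or_nonempty with rfl | hS
    · have : interFace D.A ∅ = Set.univ := by simp [interFace]
      rw [this, connectedComponentIn_univ, PreconnectedSpace.connectedComponent_eq_univ]
      exact Set.mem_univ y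
    · by_contra hne
      refine D.f_separates ⟨S, hS, x, hx⟩ y hy x hx (fun heq => hne ?_)
        (h ⟨S, hS, x, hx⟩ (Finset.Subset.refl _))
      rw [← heq]
      exact mem_connectedComponentIn hy

/-- The open face through `x`. -/
theorem connectedComponentIn_depth_eq [IsManifold (𝓠 n) ∞ M] [PreconnectedSpace M] (x : M) :
    connectedComponentIn {y : M | depth (𝓠 n) y = depth (𝓠 n) x} x =
      {y | D.hyperfacesAt y = D.hyperfacesAt x ∧
        ∀ J : IndexSets D.A, (J.1 : Set (Fin D.r)) ⊆ D.hyperfacesAt x → D.f J y = D.f J x} := by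
  classical
  obtain ⟨S, hS⟩ : ∃ S : Finset (Fin D.r), (S : Set (Fin D.r)) = D.hyperfacesAt x :=
    (Set.toFinite _).exists_finset_coe
  have hxS : x ∈ interFace D.A S := D.mem_interFace.2 hS.le
  have hx : x ∈ {y : M | depth (𝓠 n) y = depth (𝓠 n) x} := rfl
  simp only [← hS, Finset.coe_subset]
  apply Set.Subset.antisymm
  -- Nearby points lie on no new hyperfaces, so constant depth on a connected set fixes the set of
  -- hyperfaces.
  · have hconst : connectedComponentIn {y : M | depth (𝓠 n) y = depth (𝓠 n) x} x ⊆
        {y | D.hyperfacesAt y = S} := by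
      intro y hy
      exact (isPreconnected_connectedComponentIn.eq_of_ncard_eq
        (fun z _ => D.eventually_hyperfacesAt_subset z) (fun z hz => by
          rw [← D.depth_eq_ncard_hyperfacesAt]
          exact connectedComponentIn_subset {y : M | depth (𝓠 n) y = depth (𝓠 n) x} x hz)
        hy (mem_connectedComponentIn hx)).trans hS.symm
    intro y hy
    have h := isPreconnected_connectedComponentIn.subset_connectedComponentIn
      (mem_connectedComponentIn hx) (fun z hz => D.mem_interFace.2 (hconst hz).ge) hy
    exact ⟨hconst hy, ((D.mem_connectedComponentIn_interFace hxS).1 h).2⟩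
  · have h := (D.isPreconnected_interior_component S x).1.subset_connectedComponentIn
      (F := {y : M | depth (𝓠 n) y = depth (𝓠 n) x}) ⟨mem_connectedComponentIn hxS, hS.symm⟩
      (fun y hy => by
        rw [Set.mem_ofPred_eq, D.depth_eq_ncard_hyperfacesAt, D.depth_eq_ncard_hyperfacesAt,
          hy.2, hS])
    rintro y ⟨hyS, hy⟩
    exact h ⟨(D.mem_connectedComponentIn_interFace hxS).2 ⟨D.mem_interFace.2 hyS.ge, hy⟩, hyS⟩

end Choices

theorem int_eq_of_abs_sub_lt {y : ℝ} {m k : ℤ} (hm : |y - m| < 1 / 2) (hk : |y - k| < 1 / 2) :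
    m = k := by
  rw [abs_lt] at hm hk
  have h1 : (m : ℝ) < k + 1 := by linarith
  have h2 : (k : ℝ) < m + 1 := by linarith
  norm_cast at h1 h2
  omega

theorem abs_sub_int_lt_of_le {y : ℝ} {m : ℤ} (h : |y - m| ≤ 1 / 2)
    (hy : ¬ ∃ k : ℤ, y - 1 / 2 = k) : |y - m| < 1 / 2 := by
  refine lt_of_le_of_ne h fun heq => hy ?_
  rcases eq_or_eq_neg_of_abs_eq heq with h | h
  · exact ⟨m, by linarith⟩
  · exact ⟨m - 1, by push_cast; linarith⟩

theorem not_exists_int_of_abs_sub_lt {y : ℝ} {m : ℤ} (h : |y - m| < 1 / 2) :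
    ¬ ∃ k : ℤ, y - 1 / 2 = k := by
  rintro ⟨k, hk⟩
  rw [abs_lt] at h
  have h1 : (k : ℝ) + 1 < m + 1 := by linarith
  have h2 : (m : ℝ) < k + 1 := by linarith
  norm_cast at h1 h2
  omega

/-! ### Faces of `X_1` and the points that survive in `X_M` -/

namespace Choices

variable {n : ℕ} {M : Type*} [TopologicalSpace M] [ChartedSpace (EuclideanQuadrant n) M]
  (D : Choices n M)

theorem exists_int_f {J : IndexSets D.A} {x : M} (h : (J.1 : Set (Fin D.r)) ⊆ D.hyperfacesAt x) :
    ∃ m : ℤ, D.f J x = m := by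
  obtain ⟨k, -, -, hk⟩ := D.f_mem J x (D.mem_interFace.2 h)
  exact ⟨k, by simpa using hk⟩

/-- The vector space on which `X_0` is modelled. -/
abbrev E0 : Type :=
  EuclideanSpace ℝ (Fin D.N) × EuclideanSpace ℝ (Fin D.r) × EuclideanSpace ℝ (IndexSets D.A)

/-- The boundary coordinates on `E0`. -/
def xCLM : D.E0 →L[ℝ] (Fin D.r → ℝ) :=
  (EuclideanSpace.equiv (Fin D.r) ℝ).toContinuousLinearMap ∘L
    (ContinuousLinearMap.fst ℝ _ _ ∘L ContinuousLinearMap.snd ℝ _ _)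

theorem xCLM_surjective : Function.Surjective D.xCLM := fun v =>
  ⟨(0, WithLp.toLp 2 v, 0), rfl⟩

theorem range_model : Set.range D.model = {e | ∀ i, 0 ≤ D.xCLM e i} := by
  ext e
  constructor
  · rintro ⟨p, rfl⟩ i
    exact p.2.1.2 i
  · intro h
    exact ⟨((e.1, ⟨e.2.1, h⟩, e.2.2) : D.X0), rfl⟩

/-- The set of boundary coordinates that vanish at a point of `X_0`. -/
def vanishing (p : D.X0) : Set (Fin D.r) := {i | p.2.1.1 i = 0}

theorem depth_opens {U : TopologicalSpace.Opens D.X0} (p : U) :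
    depth D.model p = (D.vanishing p.1).ncard :=
  depth_eq_ncard D.xCLM D.xCLM_surjective D.range_model p

theorem mem_faceTangent_opens {U : TopologicalSpace.Opens D.X0} (p : U)
    (v : TangentSpace D.model p) :
    v ∈ faceTangent D.model p ↔ ∀ i ∈ D.vanishing p.1, D.xCLM (show D.E0 from v) i = 0 :=
  mem_faceTangent_iff D.xCLM D.range_model p v

theorem vanishing_Ψ (x : M) : D.vanishing (D.Ψ x) = D.hyperfacesAt x := by
  ext i
  exact (D.ρ_defining i).zero_iff x

theorem continuous_x (i : Fin D.r) : Continuous fun p : D.X0 => p.2.1.1 i := by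
  have : Continuous fun p : D.X0 => p.2.1.1 :=
    continuous_subtype_val.comp (continuous_fst.comp continuous_snd)
  fun_prop

theorem continuous_y (J : IndexSets D.A) : Continuous fun p : D.X0 => p.2.2 J := by
  fun_prop

theorem eventually_vanishing_subset (p : D.X0) :
    ∀ᶠ q in 𝓝 p, D.vanishing q ⊆ D.vanishing p := by
  have : ∀ᶠ q in 𝓝 p, ∀ i, q.2.1.1 i = 0 → p.2.1.1 i = 0 := by
    rw [Filter.eventually_all]
    intro i
    by_cases hi : p.2.1.1 i = 0
    · simp [hi]
    · filter_upwards [(D.continuous_x i).continuousAt.eventually_ne hi] with q hq h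
      exact absurd h hq
  exact this

theorem mem_X1_iff {p : D.X0} : p ∈ D.X1 ↔
    ∀ J : IndexSets D.A, (J.1 : Set (Fin D.r)) ⊆ D.vanishing p → ¬ ∃ m : ℤ, p.2.2 J - 1 / 2 = m := by
  change p ∈ (⋃ J, D.Y J)ᶜ ↔ _
  rw [Set.mem_compl_iff, Set.mem_iUnion, not_exists]
  exact forall_congr' fun J => ⟨fun h hJ hm => h ⟨hm, fun j hj => hJ hj⟩,
    fun h hY => h (fun j hj => hY.2 j hj) hY.1⟩

/-- The open face of `X_1` with vanishing boundary coordinates `S` at which the coordinates `y_J`,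
`J ⊆ S`, are near `c J`. -/
def openBox (S : Set (Fin D.r)) (c : IndexSets D.A → ℝ) : Set D.X0 :=
  {p | D.vanishing p = S ∧ ∀ J : IndexSets D.A, (J.1 : Set (Fin D.r)) ⊆ S → |p.2.2 J - c J| < 1 / 2}

/-- The closure in `X_1` of `openBox S c`. -/
def closedBox (S : Set (Fin D.r)) (c : IndexSets D.A → ℝ) : Set D.X0 :=
  {p | S ⊆ D.vanishing p ∧
    ∀ J : IndexSets D.A, (J.1 : Set (Fin D.r)) ⊆ S → |p.2.2 J - c J| < 1 / 2}

/-- `c J` is an integer for all `J ⊆ S`. -/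
def IsIntOn (S : Set (Fin D.r)) (c : IndexSets D.A → ℝ) : Prop :=
  ∀ J : IndexSets D.A, (J.1 : Set (Fin D.r)) ⊆ S → ∃ m : ℤ, c J = m

theorem openBox_subset_X1 {S : Set (Fin D.r)} {c : IndexSets D.A → ℝ} (hc : D.IsIntOn S c) :
    D.openBox S c ⊆ D.X1 := by
  rintro p ⟨rfl, h⟩
  refine D.mem_X1_iff.2 fun J hJ => ?_
  obtain ⟨m, hm⟩ := hc J hJ
  exact not_exists_int_of_abs_sub_lt (hm ▸ h J hJ)

theorem isPreconnected_openBox (S : Set (Fin D.r)) (c : IndexSets D.A → ℝ) :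
    IsPreconnected (D.openBox S c) := by
  have hconv : Convex ℝ (D.model '' D.openBox S c) := by
    rintro _ ⟨p, ⟨hp, hpc⟩, rfl⟩ _ ⟨q, ⟨hq, hqc⟩, rfl⟩ a b ha hb hab
    have hp' : ∀ i, p.2.1.1 i = 0 ↔ i ∈ S := fun i => Set.ext_iff.1 hp i
    have hq' : ∀ i, q.2.1.1 i = 0 ↔ i ∈ S := fun i => Set.ext_iff.1 hq i
    refine ⟨(a • p.1 + b • q.1, ⟨a • p.2.1.1 + b • q.2.1.1, fun i => ?_⟩,
      a • p.2.2 + b • q.2.2), ⟨?_, fun J hJ => ?_⟩, rfl⟩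
    · have := p.2.1.2 i
      have := q.2.1.2 i
      simp only [PiLp.add_apply, PiLp.smul_apply, smul_eq_mul]
      positivity
    · ext i
      change a * p.2.1.1 i + b * q.2.1.1 i = 0 ↔ i ∈ S
      by_cases hi : i ∈ S
      · simp [(hp' i).2 hi, (hq' i).2 hi, hi]
      · have h1 : 0 < p.2.1.1 i := lt_of_le_of_ne (p.2.1.2 i) fun h => hi ((hp' i).1 h.symm)
        have h2 : 0 < q.2.1.1 i := lt_of_le_of_ne (q.2.1.2 i) fun h => hi ((hq' i).1 h.symm)
        have : 0 < a * p.2.1.1 i + b * q.2.1.1 i := by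
          rcases ha.eq_or_lt with rfl | ha
          · have : b = 1 := by linarith
            subst this; linarith
          · positivity
        simp [this.ne', hi]
    · have := (convex_ball (c J) (1 / 2)) (x := p.2.2 J) (by simpa [Real.dist_eq] using hpc J hJ)
        (y := q.2.2 J) (by simpa [Real.dist_eq] using hqc J hJ) ha hb hab
      simpa [Real.dist_eq] using this
  exact D.model.isClosedEmbedding.isInducing.isPreconnected_image.1 hconv.isPreconnected

theorem closedBox_subset_closure_openBox (S : Set (Fin D.r)) (c : IndexSets D.A → ℝ) :
    D.closedBox S c ⊆ closure (D.openBox S c) := by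
  classical
  rintro p ⟨hpS, hp⟩
  -- The absolute value keeps `q t` in the quadrant for every real `t`.
  let q : ℝ → D.X0 := fun t => (p.1, ⟨WithLp.toLp 2 fun i => if i ∈ S then p.2.1.1 i else
    p.2.1.1 i + |t|, fun i => by
      have := p.2.1.2 i
      by_cases hi : i ∈ S
      · simpa [hi] using this
      · simp only [hi, if_false]; positivity⟩, p.2.2)
  have hq : Continuous q := by
    refine continuous_const.prodMk (Continuous.prodMk (Continuous.subtype_mk ?_ _) continuous_const)
    refine (PiLp.continuous_toLp 2 _).comp (continuous_pi fun i => ?_)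
    by_cases hi : i ∈ S
    · simpa [hi] using continuous_const
    · simp only [hi, if_false]; fun_prop
  have hq0 : q 0 = p := by
    refine Prod.ext rfl (Prod.ext (Subtype.ext ?_) rfl)
    ext i
    simp [q]
  have hlim : Filter.Tendsto q (𝓝[>] 0) (𝓝 p) := by
    have := hq.tendsto 0
    rw [hq0] at this
    exact this.mono_left nhdsWithin_le_nhds
  refine mem_closure_of_tendsto hlim ?_
  filter_upwards [self_mem_nhdsWithin] with t ht
  refine ⟨?_, hp⟩
  ext i
  change (if i ∈ S then p.2.1.1 i else p.2.1.1 i + |t|) = 0 ↔ _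
  by_cases hi : i ∈ S
  · have : p.2.1.1 i = 0 := hpS hi
    simpa [hi] using this
  · have := p.2.1.2 i
    have ht : 0 < |t| := abs_pos.2 (ne_of_gt ht)
    have : p.2.1.1 i + |t| ≠ 0 := by positivity
    simp [hi, this]

section OpenFaces

variable {D} {U : TopologicalSpace.Opens D.X0} {S : Set (Fin D.r)} {c : IndexSets D.A → ℝ}

theorem image_val_openBox (h : D.openBox S c ⊆ U) :
    Subtype.val '' ((Subtype.val : U → D.X0) ⁻¹' D.openBox S c) = D.openBox S c := by
  ext p
  exact ⟨fun ⟨q, hq, hqp⟩ => hqp ▸ hq, fun hp => ⟨⟨p, h hp⟩, hp, rfl⟩⟩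

/-- An open subset of `X_1` that contains `openBox S c` has it as an open face. -/
theorem connectedComponentIn_opens (hU : U ≤ D.X1) (hc : D.IsIntOn S c) (h : D.openBox S c ⊆ U)
    {p : U} (hp : p.1 ∈ D.openBox S c) :
    connectedComponentIn {q : U | depth D.model q = depth D.model p} p =
      Subtype.val ⁻¹' D.openBox S c := by
  apply Set.Subset.antisymm
  · set K := connectedComponentIn {q : U | depth D.model q = depth D.model p} p with hK
    have hKc : IsPreconnected K := isPreconnected_connectedComponentIn
    have hpK : p ∈ K := mem_connectedComponentIn rfl
    have hS : ∀ q ∈ K, D.vanishing q.1 = S := by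
      intro q hq
      rw [← hp.1]
      refine hKc.eq_of_ncard_eq (Z := fun q : U => D.vanishing q.1) (k := depth D.model p)
        (fun z _ => ?_) (fun z hz => ?_) hq hpK
      · exact continuous_subtype_val.continuousAt.eventually (D.eventually_vanishing_subset z.1)
      · rw [← D.depth_opens]
        exact connectedComponentIn_subset {q : U | depth D.model q = depth D.model p} p hz
    intro q hq
    refine ⟨hS q hq, fun J hJ => ?_⟩
    obtain ⟨m, hm⟩ := hc J hJ
    have hcont : Continuous fun q : U => |q.1.2.2 J - c J| :=
      (((D.continuous_y J).comp continuous_subtype_val).sub continuous_const).abs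
    -- On `K` the vanishing set is `S ⊇ J`, so `y_J` is no half-integer and its distance to the
    -- integer `c J` never equals `1/2`.
    refine hKc.subset_left_of_subset_union
      (u := {q : U | |q.1.2.2 J - c J| < 1 / 2})
      (v := {q : U | 1 / 2 < |q.1.2.2 J - c J|})
      (isOpen_lt hcont continuous_const) (isOpen_lt continuous_const hcont) ?_ ?_
      ⟨p, hpK, hp.2 J hJ⟩ hq
    · exact Set.disjoint_left.2 fun z (h1 : |z.1.2.2 J - c J| < 1 / 2)
        (h2 : 1 / 2 < |z.1.2.2 J - c J|) => lt_asymm h1 h2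
    · intro z hz
      rcases lt_or_ge (1 / 2) |z.1.2.2 J - c J| with h1 | h1
      · exact Or.inr h1
      · left
        have hJz := D.mem_X1_iff.1 (hU z.2) J (by rwa [hS z hz])
        rw [hm] at h1
        rw [Set.mem_ofPred_eq, hm]
        exact abs_sub_int_lt_of_le h1 hJz
  · refine IsPreconnected.subset_connectedComponentIn ?_ hp fun q hq => ?_
    · refine Topology.IsInducing.subtypeVal.isPreconnected_image.1 ?_
      change IsPreconnected ((Subtype.val : U → D.X0) '' _)
      rw [image_val_openBox h]
      exact D.isPreconnected_openBox S c
    · rw [Set.mem_ofPred_eq, D.depth_opens, D.depth_opens, hp.1, hq.1]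

/-- Limits only give distance at most `1/2`; equality would put the point in some `Y_J`. -/
theorem closure_openBox (hU : U ≤ D.X1) (hc : D.IsIntOn S c) (h : D.openBox S c ⊆ U) :
    closure ((Subtype.val : U → D.X0) ⁻¹' D.openBox S c) = Subtype.val ⁻¹' D.closedBox S c := by
  apply Set.Subset.antisymm
  · let C : Set D.X0 := {q : D.X0 | (∀ i ∈ S, q.2.1.1 i = 0) ∧
      ∀ J : IndexSets D.A, (J.1 : Set (Fin D.r)) ⊆ S → |q.2.2 J - c J| ≤ 1 / 2}
    have hclosed : IsClosed C := by
      simp only [C, Set.ofPred_and, Set.ofPred_forall]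
      exact (isClosed_iInter fun i => isClosed_iInter fun _ =>
          isClosed_eq (D.continuous_x i) continuous_const).inter
        (isClosed_iInter fun J => isClosed_iInter fun _ =>
          isClosed_le ((D.continuous_y J).sub continuous_const).abs continuous_const)
    intro q hq
    have hq' := closure_minimal (s := (Subtype.val : U → D.X0) ⁻¹' D.openBox S c)
      (t := (Subtype.val : U → D.X0) ⁻¹' C) (fun z hz => ⟨fun i hi => hz.1.ge hi, fun J hJ => (hz.2 J hJ).le⟩)
      (hclosed.preimage (continuous_subtype_val (p := (· ∈ U)))) hq
    refine ⟨hq'.1, fun J hJ => ?_⟩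
    obtain ⟨m, hm⟩ := hc J hJ
    have h1 := hq'.2 J hJ
    rw [hm] at h1 ⊢
    exact abs_sub_int_lt_of_le h1 (D.mem_X1_iff.1 (hU q.2) J (hJ.trans hq'.1))
  · intro q hq
    rw [closure_subtype, image_val_openBox h]
    exact D.closedBox_subset_closure_openBox S c hq

end OpenFaces

theorem mem_openBox_round {p : D.X0} (hp : p ∈ D.X1) :
    p ∈ D.openBox (D.vanishing p) fun J => round (p.2.2 J) :=
  ⟨rfl, fun J hJ => abs_sub_int_lt_of_le (abs_sub_round _) (D.mem_X1_iff.1 hp J hJ)⟩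

theorem isIntOn_round (p : D.X0) (S : Set (Fin D.r)) : D.IsIntOn S fun J => round (p.2.2 J) :=
  fun J _ => ⟨round (p.2.2 J), rfl⟩

/-- The points of `X_0` that `x ∈ M` prevents from being removed. -/
def keptBy (x : M) : Set D.X0 :=
  {p | D.vanishing p ⊆ D.hyperfacesAt x ∧
    ∀ J : IndexSets D.A, (J.1 : Set (Fin D.r)) ⊆ D.vanishing p → |p.2.2 J - D.f J x| < 1 / 2}

theorem isIntOn_f {x : M} {S : Set (Fin D.r)} (hS : S ⊆ D.hyperfacesAt x) :
    D.IsIntOn S fun J => D.f J x :=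
  fun _ hJ => D.exists_int_f (hJ.trans hS)

theorem Ψ_mem_keptBy (x : M) : D.Ψ x ∈ D.keptBy x :=
  ⟨(D.vanishing_Ψ x).le, fun J _ => by simp [Ψ]⟩

theorem mem_openBox_of_mem_keptBy {x : M} {p : D.X0} (hp : p ∈ D.keptBy x) :
    p ∈ D.openBox (D.vanishing p) fun J => D.f J x := ⟨rfl, hp.2⟩

theorem openBox_subset_keptBy {x : M} {S : Set (Fin D.r)} (hS : S ⊆ D.hyperfacesAt x) :
    D.openBox S (fun J => D.f J x) ⊆ D.keptBy x := by
  rintro p ⟨rfl, hp⟩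
  exact ⟨hS, hp⟩

theorem keptBy_subset_X1 (x : M) : D.keptBy x ⊆ D.X1 := fun _ hp =>
  D.openBox_subset_X1 (D.isIntOn_f hp.1) (D.mem_openBox_of_mem_keptBy hp)

/-- The vanishing set can only shrink nearby, and shrinking it weakens both conditions. -/
theorem isOpen_keptBy (x : M) : IsOpen (D.keptBy x) := by
  rw [isOpen_iff_eventually]
  rintro p ⟨hp, hpJ⟩
  have : ∀ᶠ q in 𝓝 p, ∀ J : IndexSets D.A, (J.1 : Set (Fin D.r)) ⊆ D.vanishing p →
      |q.2.2 J - D.f J x| < 1 / 2 := by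
    rw [Filter.eventually_all]
    intro J
    by_cases hJ : (J.1 : Set (Fin D.r)) ⊆ D.vanishing p
    · have hc : Continuous fun q : D.X0 => |q.2.2 J - D.f J x| :=
        ((D.continuous_y J).sub continuous_const).abs
      filter_upwards [hc.continuousAt.eventually_lt continuousAt_const (hpJ J hJ)] with q hq _
      exact hq
    · simp [hJ]
  filter_upwards [this, D.eventually_vanishing_subset p] with q h1 h2
  exact ⟨h2.trans hp, fun J hJ => h1 J (hJ.trans h2)⟩

theorem isFace_X1 (p : D.X1) : IsFace D.model (Subtype.val ⁻¹'
    D.closedBox (D.vanishing p.1) (fun J => round (p.1.2.2 J)) : Set D.X1) := by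
  have hint := D.isIntOn_round p.1 (D.vanishing p.1)
  rw [← closure_openBox le_rfl hint (D.openBox_subset_X1 hint),
    ← connectedComponentIn_opens le_rfl hint (D.openBox_subset_X1 hint) (D.mem_openBox_round p.2)]
  exact ⟨_, ⟨_, p, rfl, rfl⟩, rfl⟩

theorem exists_of_isFace_X1 {F : Set D.X1} (hF : IsFace D.model F) : ∃ p : D.X1,
    F = Subtype.val ⁻¹' D.closedBox (D.vanishing p.1) (fun J => round (p.1.2.2 J)) := by
  obtain ⟨_, ⟨k, p, rfl, rfl⟩, rfl⟩ := hF
  have hint := D.isIntOn_round p.1 (D.vanishing p.1)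
  refine ⟨p, ?_⟩
  rw [← closure_openBox le_rfl hint (D.openBox_subset_X1 hint),
    ← connectedComponentIn_opens le_rfl hint (D.openBox_subset_X1 hint) (D.mem_openBox_round p.2)]

/-- The smallest face through `p` has the vanishing set and rounded coordinates of `p`. If it
contains `Ψ x`, then `p ∈ keptBy x`, because the integer `f_J(x)` must be the rounded value.
Conversely, for `p ∈ keptBy x` the same comparison of integers puts `Ψ x` in every face through `p`.
-/
theorem XMset_eq : D.XMset = ⋃ x, D.keptBy x := by
  ext p
  simp only [XMset, Set.mem_image, Set.mem_compl_iff, Set.mem_sUnion, not_exists, not_and,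
    Set.mem_iUnion]
  constructor
  · rintro ⟨p, hp, rfl⟩
    have hmem : p.1 ∈ D.closedBox (D.vanishing p.1) (fun J => round (p.1.2.2 J)) :=
      ⟨le_rfl, (D.mem_openBox_round p.2).2⟩
    by_contra hne
    refine hp _ ⟨D.isFace_X1 p, ?_⟩ hmem
    rw [Set.disjoint_left]
    rintro _ ⟨q, hq, rfl⟩ ⟨x, hx⟩
    rw [Set.mem_preimage, ← hx] at hq
    refine hne ⟨x, hq.1.trans (D.vanishing_Ψ x).le, fun J hJ => ?_⟩
    obtain ⟨m, hm⟩ := D.exists_int_f (hJ.trans (hq.1.trans (D.vanishing_Ψ x).le))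
    have h1 : |D.f J x - round (p.1.2.2 J)| < 1 / 2 := hq.2 J hJ
    have h2 : m = round (p.1.2.2 J) :=
      int_eq_of_abs_sub_lt (y := D.f J x) (by rw [hm]; simp) h1
    rw [hm, h2]
    exact hmem.2 J hJ
  · rintro ⟨x, hx⟩
    refine ⟨⟨p, D.keptBy_subset_X1 x hx⟩, ?_, rfl⟩
    rintro F ⟨hF, hdisj⟩ hpF
    obtain ⟨q, rfl⟩ := D.exists_of_isFace_X1 hF
    refine Set.disjoint_left.1 hdisj
      ⟨⟨D.Ψ x, D.keptBy_subset_X1 x (D.Ψ_mem_keptBy x)⟩, ⟨?_, fun J hJ => ?_⟩, rfl⟩ ⟨x, rfl⟩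
    · rw [D.vanishing_Ψ]
      exact hpF.1.trans hx.1
    · obtain ⟨m, hm⟩ := D.exists_int_f (hJ.trans (hpF.1.trans hx.1))
      have h1 := hx.2 J (hJ.trans hpF.1)
      rw [hm] at h1
      have h2 : m = round (q.1.2.2 J) := int_eq_of_abs_sub_lt h1 (hpF.2 J hJ)
      change |D.f J x - _| < 1 / 2
      rw [hm, h2]
      simp

theorem isOpen_XMset : IsOpen D.XMset := by
  rw [XMset_eq]
  exact isOpen_iUnion D.isOpen_keptBy

theorem Ψ_mem_XMset (x : M) : D.Ψ x ∈ D.XMset := by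
  rw [XMset_eq]
  exact Set.mem_iUnion.2 ⟨x, D.Ψ_mem_keptBy x⟩

end Choices

theorem contMDiff_quadrant_mk {E' H' N : Type*} [NormedAddCommGroup E'] [NormedSpace ℝ E']
    [TopologicalSpace H'] {I' : ModelWithCorners ℝ E' H'} [TopologicalSpace N] [ChartedSpace H' N]
    {r : ℕ} {f : N → EuclideanSpace ℝ (Fin r)} (hf : ContMDiff I' (𝓡 r) ∞ f)
    (h : ∀ x i, 0 ≤ f x i) :
    ContMDiff I' (𝓠 r) ∞ (M' := EuclideanQuadrant r) (fun x => ⟨f x, h x⟩) := by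
  have h1 : ContMDiff I' (𝓠 r) ∞ ((𝓠 r).symm ∘ f) :=
    (𝓠 r).contMDiffOn_symm.comp_contMDiff hf fun x => mem_range_quadrant.2 (h x)
  convert h1 using 1
  ext x i
  simp [modelWithCornersEuclideanQuadrant, h x i]

/-! ### `X_M` as a classifying space: faces, embedding, transversality, bijection -/

namespace Choices

variable {n : ℕ} {M : Type*} [TopologicalSpace M] [ChartedSpace (EuclideanQuadrant n) M]
  (D : Choices n M)

/-- `X_M` as an open subset of `X_0`. -/
def XM : TopologicalSpace.Opens D.X0 := ⟨D.XMset, D.isOpen_XMset⟩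

/-- The map `Ψ` with values in `X_M`. -/
def ΨM (x : M) : D.XM := ⟨D.Ψ x, D.Ψ_mem_XMset x⟩

theorem exists_mem_keptBy (p : D.XM) : ∃ x, p.1 ∈ D.keptBy x := by
  have : p.1 ∈ D.XMset := p.2
  rw [XMset_eq] at this
  exact Set.mem_iUnion.1 this

theorem keptBy_subset_XM (x : M) : D.keptBy x ⊆ D.XM := fun p hp => by
  change p ∈ D.XMset
  rw [XMset_eq]
  exact Set.mem_iUnion.2 ⟨x, hp⟩

theorem XM_le_X1 : D.XM ≤ D.X1 := fun p hp => by
  obtain ⟨x, hx⟩ := D.exists_mem_keptBy ⟨p, hp⟩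
  exact D.keptBy_subset_X1 x hx

theorem openFace_XM {p : D.XM} {x : M} (hp : p.1 ∈ D.keptBy x) :
    connectedComponentIn {q : D.XM | depth D.model q = depth D.model p} p =
      Subtype.val ⁻¹' D.openBox (D.vanishing p.1) (fun J => D.f J x) :=
  connectedComponentIn_opens D.XM_le_X1 (D.isIntOn_f hp.1)
    ((D.openBox_subset_keptBy hp.1).trans (D.keptBy_subset_XM x)) (D.mem_openBox_of_mem_keptBy hp)

theorem closure_openFace_XM {p : D.XM} {x : M} (hp : p.1 ∈ D.keptBy x) :
    closure (connectedComponentIn {q : D.XM | depth D.model q = depth D.model p} p) =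
      Subtype.val ⁻¹' D.closedBox (D.vanishing p.1) (fun J => D.f J x) := by
  rw [D.openFace_XM hp, closure_openBox D.XM_le_X1 (D.isIntOn_f hp.1)
    ((D.openBox_subset_keptBy hp.1).trans (D.keptBy_subset_XM x))]

theorem f_eq_iff {J : IndexSets D.A} {x y : M} (hx : (J.1 : Set (Fin D.r)) ⊆ D.hyperfacesAt x)
    (hy : (J.1 : Set (Fin D.r)) ⊆ D.hyperfacesAt y) :
    |D.f J y - D.f J x| < 1 / 2 ↔ D.f J y = D.f J x := by
  obtain ⟨a, ha⟩ := D.exists_int_f hx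
  obtain ⟨b, hb⟩ := D.exists_int_f hy
  refine ⟨fun h => ?_, fun h => by simp [h]⟩
  rw [ha] at h
  have hba : b = a := int_eq_of_abs_sub_lt (y := D.f J y) (by rw [hb]; simp) h
  rw [ha, hb, hba]

/-- On the image of `M` the relevant `y_J` are integers, so being within `1/2` means being equal. -/
theorem preimage_openBox {x : M} {S : Set (Fin D.r)} (hS : S ⊆ D.hyperfacesAt x) :
    D.ΨM ⁻¹' (Subtype.val ⁻¹' D.openBox S fun J => D.f J x) = {y | D.hyperfacesAt y = S ∧
      ∀ J : IndexSets D.A, (J.1 : Set (Fin D.r)) ⊆ S → D.f J y = D.f J x} := by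
  ext y
  change D.vanishing (D.Ψ y) = S ∧ _ ↔ _
  rw [vanishing_Ψ]
  refine and_congr_right fun hy => forall_congr' fun J => imp_congr_right fun hJ => ?_
  exact D.f_eq_iff (hJ.trans hS) (hJ.trans hy.ge)

theorem contMDiff_x (i : Fin D.r) :
    ContMDiff D.model 𝓘(ℝ, ℝ) ∞ fun p : D.XM => p.1.2.1.1 i := by
  have h1 : ContMDiff D.model (𝓡 D.r) ∞ fun p : D.XM => p.1.2.1.1 :=
    (𝓠 D.r).contMDiff.comp (contMDiff_fst.comp (contMDiff_snd.comp contMDiff_subtype_val))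
  exact (EuclideanSpace.proj i : EuclideanSpace ℝ (Fin D.r) →L[ℝ] ℝ).contDiff.contMDiff.comp h1

theorem contMDiff_y (J : IndexSets D.A) :
    ContMDiff D.model 𝓘(ℝ, ℝ) ∞ fun p : D.XM => p.1.2.2 J := by
  have h1 : ContMDiff D.model 𝓘(ℝ, EuclideanSpace ℝ (IndexSets D.A)) ∞ fun p : D.XM => p.1.2.2 :=
    contMDiff_snd.comp (contMDiff_snd.comp contMDiff_subtype_val)
  exact (EuclideanSpace.proj J : EuclideanSpace ℝ (IndexSets D.A) →L[ℝ] ℝ).contDiff.contMDiff.comp h1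

theorem contMDiff_z : ContMDiff D.model (𝓡 D.N) ∞ fun p : D.XM => p.1.1 :=
  contMDiff_fst.comp contMDiff_subtype_val

theorem contMDiff_euclidean {E' H' N : Type*} [NormedAddCommGroup E'] [NormedSpace ℝ E']
    [TopologicalSpace H'] {I' : ModelWithCorners ℝ E' H'} [TopologicalSpace N] [ChartedSpace H' N]
    {ι : Type*} [Fintype ι] {f : N → ι → ℝ} (hf : ∀ i, ContMDiff I' 𝓘(ℝ, ℝ) ∞ fun x => f x i) :
    ContMDiff I' 𝓘(ℝ, EuclideanSpace ℝ ι) ∞ fun x => WithLp.toLp 2 (f x) :=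
  (EuclideanSpace.equiv ι ℝ).symm.contDiff.contMDiff.comp (contMDiff_pi_space.2 hf)

theorem contMDiff_ΨM : ContMDiff (𝓠 n) D.model ∞ D.ΨM := by
  rw [← ContMDiff.subtypeVal_comp_iff]
  exact D.φ_smooth.prodMk ((contMDiff_quadrant_mk (contMDiff_euclidean fun i =>
    (D.ρ_defining i).smooth) _).prodMk (contMDiff_euclidean D.f_smooth))

theorem hasMFDerivAt_x (i : Fin D.r) (p : D.XM) :
    HasMFDerivAt D.model 𝓘(ℝ, ℝ) (fun p : D.XM => p.1.2.1.1 i) p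
      ((ContinuousLinearMap.proj (R := ℝ) (φ := fun _ : Fin D.r => ℝ) i).comp D.xCLM) :=
  hasMFDerivAt_of_eq_comp_extChartAt (L := (ContinuousLinearMap.proj (R := ℝ)
    (φ := fun _ : Fin D.r => ℝ) i).comp D.xCLM) fun _ => rfl

theorem hasMFDerivAt_z (p : D.XM) :
    HasMFDerivAt D.model (𝓡 D.N) (fun p : D.XM => p.1.1) p
      (ContinuousLinearMap.fst ℝ (EuclideanSpace ℝ (Fin D.N))
        (EuclideanSpace ℝ (Fin D.r) × EuclideanSpace ℝ (IndexSets D.A))) :=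
  hasMFDerivAt_of_eq_comp_extChartAt (L := ContinuousLinearMap.fst ℝ (EuclideanSpace ℝ (Fin D.N))
        (EuclideanSpace ℝ (Fin D.r) × EuclideanSpace ℝ (IndexSets D.A))) fun _ => rfl

theorem mdifferentiableAt_ΨM (x : M) : MDifferentiableAt (𝓠 n) D.model D.ΨM x :=
  D.contMDiff_ΨM.mdifferentiableAt (by simp)

theorem mfderiv_ρ_apply (i : Fin D.r) (x : M) (ξ : EuclideanSpace ℝ (Fin n)) :
    (mfderiv (𝓠 n) 𝓘(ℝ, ℝ) (D.ρ i) x : EuclideanSpace ℝ (Fin n) →L[ℝ] ℝ) ξ =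
      D.xCLM ((mfderiv (𝓠 n) D.model D.ΨM x : EuclideanSpace ℝ (Fin n) →L[ℝ] D.E0) ξ) i := by
  have h := ((D.hasMFDerivAt_x i (D.ΨM x)).comp x (D.mdifferentiableAt_ΨM x).hasMFDerivAt).mfderiv
  exact DFunLike.congr_fun h ξ

theorem mfderiv_φ_apply (x : M) (ξ : EuclideanSpace ℝ (Fin n)) :
    (mfderiv (𝓠 n) (𝓡 D.N) D.φ x : EuclideanSpace ℝ (Fin n) →L[ℝ] EuclideanSpace ℝ (Fin D.N)) ξ =
      ((mfderiv (𝓠 n) D.model D.ΨM x : EuclideanSpace ℝ (Fin n) →L[ℝ] D.E0) ξ).1 := by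
  have h := ((D.hasMFDerivAt_z (D.ΨM x)).comp x (D.mdifferentiableAt_ΨM x).hasMFDerivAt).mfderiv
  exact DFunLike.congr_fun h ξ

theorem isPreconnected_A (i : Fin D.r) : IsPreconnected (D.A i) := by
  obtain ⟨_, ⟨x, -, rfl⟩, h⟩ := D.isHyperface i
  rw [h]
  exact isPreconnected_connectedComponentIn.closure

/-- A hyperface is connected, so the wall `x_i = 0` carries only one label in `X_M` and is a single
hyperface there. -/
theorem f_eq_of_mem_A {i : Fin D.r} {x y : M} (hx : x ∈ D.A i) (hy : y ∈ D.A i)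
    {J : IndexSets D.A} (hJ : (J.1 : Set (Fin D.r)) ⊆ {i}) : D.f J x = D.f J y :=
  D.f_eq_of_isPreconnected J (D.isPreconnected_A i)
    (fun _ hz => D.mem_interFace.2 (hJ.trans (Set.singleton_subset_iff.2 hz))) hx hy

theorem hasEmbeddedFaces_XM : HasEmbeddedFaces D.model D.XM := by
  rintro _ ⟨_, ⟨q, hq, rfl⟩, rfl⟩
  obtain ⟨x, hx⟩ := D.exists_mem_keptBy q
  rw [← hq, D.closure_openFace_XM hx]
  rw [D.depth_opens] at hq
  obtain ⟨i, hi⟩ := Set.ncard_eq_one.1 hq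
  rw [hi]
  have hix : x ∈ D.A i := hx.1 (hi ▸ Set.mem_singleton i)
  -- The coordinate `x_i` is the defining function: its zero set is the whole hyperface because
  -- `f_{i}` takes one value on `A i`.
  refine ⟨fun p => p.1.2.1.1 i, fun p => p.1.2.1.2 i, D.contMDiff_x i, fun p => ?_, fun p _ h => ?_⟩
  · refine ⟨fun hp => ⟨Set.singleton_subset_iff.2 hp, fun J hJ => ?_⟩,
      fun hp => hp.1 (Set.mem_singleton i)⟩
    obtain ⟨x', hx'⟩ := D.exists_mem_keptBy p
    have := hx'.2 J (hJ.trans (Set.singleton_subset_iff.2 hp))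
    rwa [D.f_eq_of_mem_A (hx'.1 hp) hix hJ] at this
  · rw [(D.hasMFDerivAt_x i p).mfderiv] at h
    have h1 := DFunLike.congr_fun h
      ((0, EuclideanSpace.single i 1, 0) : D.E0)
    have h2 : (EuclideanSpace.single i (1 : ℝ) : EuclideanSpace ℝ (Fin D.r)) i = 0 := h1
    simp at h2

instance : T2Space D.X0 := D.model.isClosedEmbedding.isEmbedding.t2Space

theorem isEmbedding_ΨM : Topology.IsEmbedding D.ΨM :=
  Topology.IsEmbedding.of_comp D.contMDiff_ΨM.continuous D.contMDiff_z.continuous D.φ_isEmbedding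

variable [IsManifold (𝓠 n) ∞ M]

theorem isClosedCornerEmbedding_ΨM [CompactSpace M] :
    IsClosedCornerEmbedding (𝓠 n) D.model D.ΨM where
  smooth := D.contMDiff_ΨM
  injective := D.isEmbedding_ΨM.injective
  isClosed_range := (isCompact_range D.contMDiff_ΨM.continuous).isClosed
  mfderiv_injective x ξ η h := by
    refine D.φ_immersion x ?_
    refine (D.mfderiv_φ_apply x ξ).trans (Eq.trans ?_ (D.mfderiv_φ_apply x η).symm)
    exact congrArg (fun v : D.E0 => v.1) h
  transverse F hF x hx := by
    rw [eq_top_iff]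
    intro w _
    -- Matching the vanishing boundary coordinates of `w` by some `dΨ ξ` leaves a remainder tangent
    -- to the face.
    obtain ⟨ξ, hξ⟩ := D.exists_mfderiv_eq x (D.xCLM w)
    refine Submodule.mem_sup.2 ⟨_, ⟨ξ, rfl⟩, w - mfderiv (𝓠 n) D.model D.ΨM x ξ, ?_, ?_⟩
    · rw [D.mem_faceTangent_opens]
      intro i hi
      have h1 := hξ i ((D.vanishing_Ψ x).le hi)
      rw [D.mfderiv_ρ_apply] at h1
      have h2 : ∀ u v : D.E0, D.xCLM v i = D.xCLM u i → D.xCLM (u - v) i = 0 := fun u v h => by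
        rw [map_sub, Pi.sub_apply, h, sub_self]
      exact h2 w _ h1
    · exact add_sub_cancel _ _
  hyperface A hA := by
    have hA' : A ∈ Set.range D.A := by rw [D.range_A]; exact hA
    obtain ⟨i, rfl⟩ := hA'
    obtain ⟨_, ⟨x, hx, rfl⟩, hAi⟩ := hA
    have hxi : x ∈ D.A i := hAi ▸ subset_closure (mem_connectedComponentIn hx)
    rw [D.depth_eq_ncard_hyperfacesAt] at hx
    obtain ⟨j, hj⟩ := Set.ncard_eq_one.1 hx
    have hij : i = j := Set.mem_singleton_iff.1 (hj ▸ hxi : i ∈ ({j} : Set (Fin D.r)))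
    subst hij
    have hd : depth D.model (D.ΨM x) = 1 := by
      rw [D.depth_opens]
      change (D.vanishing (D.Ψ x)).ncard = 1
      rw [D.vanishing_Ψ, hx]
    have hv : D.vanishing (D.ΨM x).1 = {i} := (D.vanishing_Ψ x).trans hj
    -- The preimage is all of `A i`, already connected, so it is its own component.
    have hpre : D.ΨM ⁻¹' closure
        (connectedComponentIn {q : D.XM | depth D.model q = depth D.model (D.ΨM x)} (D.ΨM x)) =
        D.A i := by
      rw [D.closure_openFace_XM (D.Ψ_mem_keptBy x), hv]
      ext y
      change {i} ⊆ D.vanishing (D.Ψ y) ∧ _ ↔ _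
      rw [D.vanishing_Ψ, Set.singleton_subset_iff]
      refine ⟨fun h => h.1, fun h => ⟨h, fun J hJ => ?_⟩⟩
      change |D.f J y - D.f J x| < 1 / 2
      rw [D.f_eq_of_mem_A h hxi hJ]
      simp
    refine ⟨_, ⟨_, ⟨D.ΨM x, hd, rfl⟩, rfl⟩, x, ?_, ?_⟩
    · exact subset_closure (mem_connectedComponentIn hd)
    · rw [← hd, hpre, (D.isPreconnected_A i).connectedComponentIn hxi]

theorem isOpenFace_preimage [PreconnectedSpace M] {F : Set D.XM} (hF : IsOpenFace D.model F) :
    IsOpenFace (𝓠 n) (D.ΨM ⁻¹' F) := by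
  obtain ⟨_, q, rfl, rfl⟩ := hF
  obtain ⟨x, hx⟩ := D.exists_mem_keptBy q
  obtain ⟨S, hS⟩ : ∃ S : Finset (Fin D.r), (S : Set (Fin D.r)) = D.vanishing q.1 :=
    (Set.toFinite _).exists_finset_coe
  rw [D.openFace_XM hx, D.preimage_openBox hx.1, ← hS]
  have hxS : x ∈ interFace D.A S := D.mem_interFace.2 (hS ▸ hx.1)
  -- Hyperfaces outside `S` may pass through `x`; by density the same component of `F_S` contains a
  -- point `y` on exactly those in `S`.
  obtain ⟨y, hy, hyS⟩ := closure_nonempty_iff.1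
    ⟨x, (D.isPreconnected_interior_component S x).2 (mem_connectedComponentIn hxS)⟩
  rw [D.mem_connectedComponentIn_interFace hxS] at hy
  refine ⟨_, y, rfl, ?_⟩
  rw [D.connectedComponentIn_depth_eq]
  have hyS' : D.hyperfacesAt y = S := hyS
  rw [hyS']
  ext z
  refine and_congr_right fun _ => forall_congr' fun J => imp_congr_right fun hJ => ?_
  rw [hy.2 J (Finset.coe_subset.1 hJ)]

/-- Injectivity: preimages of open faces are nonempty, and a point lies in only one open face.
Surjectivity: the open face through `x` is the preimage of the one through `Ψ x`, which has the same
label. -/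
theorem bijOn_preimage_ΨM [PreconnectedSpace M] :
    Set.BijOn (fun F : Set D.XM => D.ΨM ⁻¹' F) {F | IsOpenFace D.model F}
      {F | IsOpenFace (𝓠 n) F} := by
  refine ⟨fun F hF => D.isOpenFace_preimage hF, fun F hF G hG h => ?_, ?_⟩
  · obtain ⟨k, y, hk, hy⟩ := D.isOpenFace_preimage hF
    have hyF : D.ΨM y ∈ F := by
      change y ∈ D.ΨM ⁻¹' F
      rw [hy]
      exact mem_connectedComponentIn hk
    have hyG : D.ΨM y ∈ G := by
      change y ∈ D.ΨM ⁻¹' G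
      have h' : D.ΨM ⁻¹' F = D.ΨM ⁻¹' G := h
      rw [← h']
      exact hyF
    have key : ∀ F : Set D.XM, IsOpenFace D.model F → D.ΨM y ∈ F → F =
        connectedComponentIn {q : D.XM | depth D.model q = depth D.model (D.ΨM y)} (D.ΨM y) := by
      rintro _ ⟨k, q, -, rfl⟩ h
      have h1 : depth D.model (D.ΨM y) = k :=
        connectedComponentIn_subset {q : D.XM | depth D.model q = k} q h
      rw [h1, connectedComponentIn_eq h]
    rw [key F hF hyF, key G hG hyG]
  · rintro _ ⟨_, x, rfl, rfl⟩
    refine ⟨_, ⟨_, D.ΨM x, rfl, rfl⟩, ?_⟩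
    have hv : D.vanishing (D.ΨM x).1 = D.hyperfacesAt x := D.vanishing_Ψ x
    change D.ΨM ⁻¹' _ = _
    rw [D.openFace_XM (D.Ψ_mem_keptBy x), D.preimage_openBox hv.le, hv,
      D.connectedComponentIn_depth_eq]

end Choices

/-! ### Open faces of `X_M` are Euclidean -/

namespace Choices

variable {n : ℕ} {M : Type*} [TopologicalSpace M] [ChartedSpace (EuclideanQuadrant n) M]
  (D : Choices n M)

instance (S : Set (Fin D.r)) : Fintype {i // i ∉ S} := by
  classical exact inferInstance

/-- The vector space that parametrizes `openBox S c`. -/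
abbrev BoxSpace (S : Set (Fin D.r)) : Type :=
  EuclideanSpace ℝ (Fin D.N) × ({i // i ∉ S} → ℝ) × (IndexSets D.A → ℝ)

open Classical in
/-- The parametrization of `openBox S c`. -/
def boxParam (S : Set (Fin D.r)) (c : IndexSets D.A → ℝ) (v : D.BoxSpace S) : D.X0 :=
  (v.1, ⟨WithLp.toLp 2 fun i => if hi : i ∈ S then 0 else Real.exp (v.2.1 ⟨i, hi⟩), fun i => by
    by_cases hi : i ∈ S
    · simp [hi]
    · simpa [hi] using (Real.exp_pos _).le⟩,
  WithLp.toLp 2 fun J => if (J.1 : Set (Fin D.r)) ⊆ S then c J + Real.arctan (v.2.2 J) / Real.pi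
    else v.2.2 J)

open Classical in
/-- The inverse of `boxParam`. -/
def boxCoord (S : Set (Fin D.r)) (c : IndexSets D.A → ℝ) (p : D.X0) : D.BoxSpace S :=
  (p.1, fun i => Real.log (p.2.1.1 i.1), fun J => if (J.1 : Set (Fin D.r)) ⊆ S then
    Real.tan (Real.pi * (p.2.2 J - c J)) else p.2.2 J)

variable {S : Set (Fin D.r)} {c : IndexSets D.A → ℝ}

/-- `exp` sweeps out the positive half-line, and `arctan / π` takes values in `(-1/2, 1/2)`, the
width of the box. -/
theorem boxParam_mem (v : D.BoxSpace S) : D.boxParam S c v ∈ D.openBox S c := by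
  classical
  constructor
  · ext i
    change (if hi : i ∈ S then 0 else Real.exp (v.2.1 ⟨i, hi⟩)) = 0 ↔ _
    by_cases hi : i ∈ S
    · simp [hi]
    · simp [hi, Real.exp_ne_zero]
  · intro J hJ
    have h1 := Real.neg_pi_div_two_lt_arctan (v.2.2 J)
    have h2 := Real.arctan_lt_pi_div_two (v.2.2 J)
    simp only [boxParam, hJ, if_true, add_sub_cancel_left, abs_div, abs_of_pos Real.pi_pos]
    rw [div_lt_iff₀ Real.pi_pos, abs_lt]
    constructor <;> linarith

theorem boxCoord_boxParam (v : D.BoxSpace S) : D.boxCoord S c (D.boxParam S c v) = v := by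
  classical
  refine Prod.ext rfl (Prod.ext (funext fun i => ?_) (funext fun J => ?_))
  · change Real.log (if hi : i.1 ∈ S then 0 else Real.exp (v.2.1 ⟨i.1, hi⟩)) = _
    rw [dif_neg i.2, Real.log_exp]
  · by_cases hJ : (J.1 : Set (Fin D.r)) ⊆ S
    · simp only [boxParam, boxCoord, hJ, if_true, add_sub_cancel_left]
      rw [mul_div_cancel₀ _ Real.pi_ne_zero, Real.tan_arctan]
    · simp [boxParam, boxCoord, hJ]

theorem pi_mul_mem_Ioo {y c : ℝ} (h : |y - c| < 1 / 2) :
    Real.pi * (y - c) ∈ Set.Ioo (-(Real.pi / 2)) (Real.pi / 2) := by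
  have := Real.pi_pos
  rw [abs_lt] at h
  constructor <;> nlinarith

theorem boxParam_boxCoord {p : D.X0} (hp : p ∈ D.openBox S c) :
    D.boxParam S c (D.boxCoord S c p) = p := by
  classical
  have hp' : ∀ i, p.2.1.1 i = 0 ↔ i ∈ S := fun i => Set.ext_iff.1 hp.1 i
  refine Prod.ext rfl (Prod.ext (Subtype.ext ?_) ?_)
  · ext i
    change (if hi : i ∈ S then 0 else Real.exp (Real.log (p.2.1.1 i))) = p.2.1.1 i
    by_cases hi : i ∈ S
    · simp [hi, (hp' i).2 hi]
    · rw [dif_neg hi, Real.exp_log]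
      exact lt_of_le_of_ne (p.2.1.2 i) fun h => hi ((hp' i).1 h.symm)
  · ext J
    by_cases hJ : (J.1 : Set (Fin D.r)) ⊆ S
    · have h := pi_mul_mem_Ioo (hp.2 J hJ)
      simp only [boxParam, boxCoord, hJ, if_true]
      rw [Real.arctan_tan h.1 h.2, mul_div_cancel_left₀ _ Real.pi_ne_zero, add_sub_cancel]
    · simp [boxParam, boxCoord, hJ]

theorem contMDiff_boxParam :
    ContMDiff 𝓘(ℝ, D.BoxSpace S) D.model ∞ (D.boxParam S c) := by
  classical
  refine ContMDiff.prodMk contDiff_fst.contMDiff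
    ((contMDiff_quadrant_mk (contMDiff_euclidean fun i => ?_) _).prodMk
      (contMDiff_euclidean fun J => ?_))
  · by_cases hi : i ∈ S
    · simpa [hi] using contMDiff_const
    · simp only [hi, dif_neg, not_false_iff]
      refine ContDiff.contMDiff (Real.contDiff_exp.comp ?_)
      exact (contDiff_apply ℝ ℝ (⟨i, hi⟩ : {i // i ∉ S})).comp (contDiff_fst.comp contDiff_snd)
  · have h : ContDiff ℝ ∞ fun v : D.BoxSpace S => v.2.2 J :=
      (contDiff_apply ℝ ℝ J).comp (contDiff_snd.comp contDiff_snd)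
    by_cases hJ : (J.1 : Set (Fin D.r)) ⊆ S
    · simp only [hJ, if_true]
      exact (contDiff_const.add ((Real.contDiff_arctan.comp h).div_const _)).contMDiff
    · simpa only [hJ, if_false] using h.contMDiff

theorem contMDiffOn_boxCoord : ContMDiffOn D.model 𝓘(ℝ, D.BoxSpace S) ∞
    (fun p : D.XM => D.boxCoord S c p.1) (Subtype.val ⁻¹' D.openBox S c) := by
  classical
  intro p hp
  refine D.contMDiff_z.contMDiffAt.contMDiffWithinAt.prodMk_space (ContMDiffWithinAt.prodMk_space
    (contMDiffWithinAt_pi_space.2 fun i => ?_) (contMDiffWithinAt_pi_space.2 fun J => ?_))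
  · have hne : p.1.2.1.1 i.1 ≠ 0 := fun h => i.2 (hp.1.le h)
    exact (Real.contDiffAt_log.2 hne).contMDiffAt.comp_contMDiffWithinAt p
      (D.contMDiff_x i.1).contMDiffAt.contMDiffWithinAt
  · by_cases hJ : (J.1 : Set (Fin D.r)) ⊆ S
    · simp only [hJ, if_true]
      have hcos := (Real.cos_pos_of_mem_Ioo (pi_mul_mem_Ioo (hp.2 J hJ))).ne'
      have h : ContDiffAt ℝ ∞ (fun y : ℝ => Real.tan (Real.pi * (y - c J))) (p.1.2.2 J) :=
        ContDiffAt.comp (g := Real.tan) (f := fun y => Real.pi * (y - c J)) (p.1.2.2 J)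
          (Real.contDiffAt_tan.2 hcos) (by fun_prop)
      exact ContMDiffAt.comp_contMDiffWithinAt (g := fun y : ℝ => Real.tan (Real.pi * (y - c J)))
        (f := fun p : D.XM => p.1.2.2 J) p h.contMDiffAt
        (D.contMDiff_y J).contMDiffAt.contMDiffWithinAt
    · simpa only [hJ, if_false] using (D.contMDiff_y J).contMDiffAt.contMDiffWithinAt

theorem isDiffeomorphicToEuclidean_openBox (h : D.openBox S c ⊆ D.XM) :
    IsDiffeomorphicToEuclidean D.model ((Subtype.val : D.XM → D.X0) ⁻¹' D.openBox S c) := by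
  let e : D.BoxSpace S ≃L[ℝ] EuclideanSpace ℝ (Fin (Module.finrank ℝ (D.BoxSpace S))) := toEuclidean
  refine ⟨_, fun v => ⟨D.boxParam S c (e.symm v), h (D.boxParam_mem _)⟩,
    fun p => e (D.boxCoord S c p.1), ?_, ?_, fun v => D.boxParam_mem _, fun v => ?_, fun p hp => ?_⟩
  · rw [← ContMDiff.subtypeVal_comp_iff]
    exact D.contMDiff_boxParam.comp e.symm.contDiff.contMDiff
  · exact e.contDiff.contMDiff.comp_contMDiffOn D.contMDiffOn_boxCoord
  · simp only [D.boxCoord_boxParam, e.apply_symm_apply]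
  · refine Subtype.ext ?_
    simp only [e.symm_apply_apply]
    exact D.boxParam_boxCoord hp

theorem isDiffeomorphicToEuclidean_openFace {F : Set D.XM} (hF : IsOpenFace D.model F) :
    IsDiffeomorphicToEuclidean D.model F := by
  obtain ⟨_, q, rfl, rfl⟩ := hF
  obtain ⟨x, hx⟩ := D.exists_mem_keptBy q
  rw [D.openFace_XM hx]
  exact D.isDiffeomorphicToEuclidean_openBox
    ((D.openBox_subset_keptBy hx.1).trans (D.keptBy_subset_XM x))

end Choices

end Corners

end

theorem mainTheorem7 {n : ℕ} {M : Type*} [TopologicalSpace M] [T2Space M] [CompactSpace M]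
    [PreconnectedSpace M] [ChartedSpace (EuclideanQuadrant n) M]
    [IsManifold (modelWithCornersEuclideanQuadrant n) ∞ M]
    (D : Corners.Choices n M) :
    ∃ (hopen : IsOpen D.XMset) (hmem : ∀ x : M, D.Ψ x ∈ D.XMset),
      Corners.IsClassifyingSpace (modelWithCornersEuclideanQuadrant n) D.model
        (X := (⟨D.XMset, hopen⟩ : TopologicalSpace.Opens D.X0))
        (fun x : M => ⟨D.Ψ x, hmem x⟩) :=
  ⟨D.isOpen_XMset, D.Ψ_mem_XMset,
    { embeddedFaces := D.hasEmbeddedFaces_XM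
      closedEmbedding := D.isClosedCornerEmbedding_ΨM
      isEmbedding := D.isEmbedding_ΨM
      euclidean := fun _ hF => D.isDiffeomorphicToEuclidean_openFace hF
      bijOn := D.bijOn_preimage_ΨM }⟩
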